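/- Let $\Bbbk$ be a commutative ring and let $A=A_{\bar 0}\oplus A_{\bar 1}$ be an associative unital $\Bbbk$-superalgebra that is finitely generated and free as a $\Bbbk$-module. For integers $n\ge d\ge 0$ we use the following notation. *Tensor powers.* For a $\Bbbk$-supermodule $M$, the symmetric group $\mathfrak S_d$ acts on $M^{\otimes d}$ from the right by signed permutations: for homogeneous $v_i$, $(v_1\otimes\cdots\otimes v_d).\sigma=\pm\, v_{\sigma 1}\otimes\cdots\otimes v_{\sigma d}$, where the sign is the product of $(-1)^{|v_{\sigma i}||v_{\sigma j}|}$ over all $i<j$ with $\sigma i>\sigma j$. Put $\Gamma^dM=(M^{\otimes d})^{\mathfrak S_d}$. Tensor powers of bilinear maps are formed with the rule of signs. *Categories.* $\mathcal E_A$ is the category of evenly generated projective right $A$-supermodules (even quotients of some $A^m$, $m\ge 0$, that are projective) with all $A$-linear maps. The category $\Gamma^d\mathcal E_A$ has the same objects, $\mathrm{Hom}_{\Gamma^d\mathcal E_A}(X,Y)=\Gamma^d\,\mathrm{Hom}_A(X,Y)$, and the composition induced by the $d$-th tensor power of the composition of $\mathcal E_A$. Consider even $\Bbbk$-linear functors from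 $\Gamma^d\mathcal E_A$ to $\Bbbk$-supermodules. A morphism $F\to G$ of degree $e$ is a family of maps $\eta_X:F(X)\to G(X)$ of degree $e$ with $G(\varphi)\eta_X=(-1)^{|\varphi||\eta|}\eta_YF(\varphi)$ for all homogeneous $\varphi:X\to Y$; a general morphism is a sum of an even and an odd one. $\mathcal P^A_d$ is the full subcategory of those functors whose values are finitely generated projective $\Bbbk$-supermodules. Put $\Gamma^{d,n}=\mathrm{Hom}_{\Gamma^d\mathcal E_A}(A^n,-)$, and let $\otimes^d\in\mathcal P^A_d$ be the functor $X\mapsto X^{\otimes d}$, with $\Gamma^d\,\mathrm{Hom}_A(X,Y)$ acting through the $d$-th tensor power of evaluation. *Superalgebras.* $S^A(n,d)=\Gamma^d\,\mathrm{End}_A(A^n)$ is the endomorphism superalgebra of $A^n$ in $\Gamma^d\mathcal E_A$. The wreath product $A\wr\mathfrak S_d$ is $A^{\otimes d}\otimes\Bbbk\mathfrak S_d$, with $\Bbbk\mathfrak S_d$ even and multiplication $(x\otimes\rho)(y\otimes\sigma)=x\,(y.\rho^{-1})\otimes\rho\sigma$. For $X\in\mathcal E_A$ it acts on $X^{\otimes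 d}$ from the right by $v\cdot(x\otimes\rho)=(vx).\rho$. For a superalgebra $R$, $R^{\mathrm{sop}}$ is the supermodule $R$ with the product $a*b=(-1)^{|a||b|}ba$. Let $n\ge d$ and $V=A^n$. Then: 1. The left $S^A(n,d)$-supermodule $V^{\otimes d}$ is finitely generated and is a projective $S^A(n,d)$-supermodule. The evaluation $\alpha\mapsto\alpha_V(\mathrm{id})$ is an even isomorphism of left $S^A(n,d)$-supermodules $$\mathrm{Hom}(\Gamma^{d,n},\otimes^d)\;\cong\;V^{\otimes d},$$ where $\mathrm{Hom}$ consists of all morphisms of functors as above, and $s\in S^A(n,d)$ acts by $s\cdot\alpha=(-1)^{|s||\alpha|}\alpha\circ h^s$. Here $h^s:\Gamma^{d,n}\to\Gamma^{d,n}$ is $h^s(\varphi)=(-1)^{|s||\varphi|}\varphi\circ s$. 2. There is an isomorphism of superalgebras $$\Phi:\ A\wr\mathfrak S_d\ \xrightarrow{\ \sim\ }\ \mathrm{End}_{\mathcal P^A_d}(\otimes^d)^{\mathrm{sop}},$$ given canonically by $\Phi(w)_X(v)=(-1)^{|w||v|}\,v\cdot w$ for homogeneous $w\in A\wr\mathfrak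 S_d$ and $v\in X^{\otimes d}$. The superscript $\mathrm{sop}$ records that the product of $\mathrm{End}_{\mathcal P^A_d}(\otimes^d)$ before taking $\mathrm{sop}$ is the ordinary composition $\eta\circ\theta$. 3. With the action $w\cdot\alpha=(-1)^{|w||\alpha|}\alpha\circ\Phi(w)$, the assignment $F\mapsto\mathrm{Hom}_{\mathcal P^A_d}(\otimes^d,F)$ is an exact functor from $\mathcal P^A_d$ to the category of finitely generated left $A\wr\mathfrak S_d$-supermodules (the generalized Schur–Weyl duality functor). Exact means that it sends pairs of even morphisms $F\to G\to H$ for which $0\to F(X)\to G(X)\to H(X)\to 0$ is exact for every $X$ to short exact sequences. -/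

import Mathlib

open scoped TensorProduct

noncomputable section

set_option linter.unusedVariables false
set_option linter.unusedSectionVars false
set_option linter.checkUnivs false

namespace SuperPoly

universe u v w x y

/-! ### Signs and supermodules -/

/-- The sign `(-1)^e` for `e` in `ℤ/2`, as an element of the ground ring. -/
def sgn (k : Type u) [CommRing k] (e : ZMod 2) : k := (-1) ^ e.val

theorem sgn_zero (k : Type u) [CommRing k] : sgn k 0 = 1 := by simp [sgn]

theorem zmod_two (e : ZMod 2) : e = 0 ∨ e = 1 := by revert e; decide

theorem sgn_add (k : Type u) [CommRing k] (a b : ZMod 2) :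
    sgn k (a + b) = sgn k a * sgn k b := by
  have h2 : (1 + 1 : ZMod 2) = 0 := by decide
  rcases zmod_two a with rfl | rfl <;> rcases zmod_two b with rfl | rfl <;>
    simp [sgn, ZMod.val_one, h2]

/-- A `k`-supermodule structure on a `k`-module `M`: submodules `homog 0` (even elements) and
`homog 1` (odd elements) with `M = homog 0 ⊕ homog 1`. -/
class SuperModule (k : Type u) (M : Type v) [CommRing k] [AddCommGroup M] [Module k M] where
  homog : ZMod 2 → Submodule k M
  isCompl : IsCompl (homog 0) (homog 1)

/-- The submodule `M_i` of homogeneous elements of degree `i` of a supermodule. -/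
def homog (k : Type u) {M : Type v} [CommRing k] [AddCommGroup M] [Module k M]
    [SuperModule k M] (i : ZMod 2) : Submodule k M := SuperModule.homog i

section basics
variable {k : Type u} [CommRing k] {M : Type v} [AddCommGroup M] [Module k M] [SuperModule k M]
  {N : Type w} [AddCommGroup N] [Module k N] [SuperModule k N]
  {P : Type x} [AddCommGroup P] [Module k P]
  {Q : Type y} [AddCommGroup Q] [Module k Q]

theorem isCompl_homog (i : ZMod 2) : IsCompl (homog k (M := M) i) (homog k (i + 1)) := by
  rcases zmod_two i with rfl | rfl
  · exact SuperModule.isCompl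
  · exact (SuperModule.isCompl (k := k) (M := M)).symm

/-- The projection of `M` onto its homogeneous component of degree `i`. -/
def proj (k : Type u) [CommRing k] {M : Type v} [AddCommGroup M] [Module k M] [SuperModule k M]
    (i : ZMod 2) : M →ₗ[k] M :=
  Submodule.projection (homog k i) (homog k (i + 1)) (isCompl_homog i)

theorem proj_mem (i : ZMod 2) (m : M) : proj k i m ∈ homog k (M := M) i :=
  Submodule.projection_apply_mem _ _

theorem proj_of_mem {i : ZMod 2} {m : M} (h : m ∈ homog k i) : proj k i m = m :=
  Submodule.projection_apply_of_mem_left _ h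

theorem proj_of_mem_ne {i j : ZMod 2} {m : M} (h : m ∈ homog k j) (hij : j ≠ i) :
    proj k i m = 0 := by
  have : j = i + 1 := by
    clear h
    revert i j
    decide
  subst this
  exact Submodule.projection_apply_of_mem_right _ h

theorem proj_of_mem_ite {i j : ZMod 2} {m : M} (h : m ∈ homog k j) :
    proj k i m = if i = j then m else 0 := by
  split_ifs with e
  · subst e; exact proj_of_mem h
  · exact proj_of_mem_ne h (Ne.symm e)

theorem sum_zmod {α : Type*} [AddCommMonoid α] (f : ZMod 2 → α) : ∑ i, f i = f 0 + f 1 :=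
  Fin.sum_univ_two f

theorem sum_proj (m : M) : ∑ i, proj k i m = m := by
  rw [sum_zmod]
  exact Submodule.projection_add_projection_eq_self (isCompl_homog (k := k) (M := M) 0) m

theorem eq_zero_of_mem {i j : ZMod 2} {m : M} (h : m ∈ homog k i) (h' : m ∈ homog k j)
    (hij : i ≠ j) : m = 0 := by
  rw [← proj_of_mem h', proj_of_mem_ne h hij]

theorem homog_induction {p : M → Prop} (m : M) (hadd : ∀ a b, p a → p b → p (a + b))
    (h : ∀ i, ∀ a ∈ homog k (M := M) i, p a) : p m := by
  rw [← sum_proj (k := k) m, sum_zmod]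
  exact hadd _ _ (h _ _ (proj_mem _ _)) (h _ _ (proj_mem _ _))

theorem mem_submodule_of_proj (S : Submodule k M) {m : M} (h : ∀ i, proj k i m ∈ S) : m ∈ S := by
  rw [← sum_proj (k := k) m]
  exact S.sum_mem fun i _ => h i

theorem ext_homog {f g : M →ₗ[k] P} (h : ∀ i, ∀ m ∈ homog k (M := M) i, f m = g m) : f = g := by
  ext m
  refine homog_induction (k := k) (p := fun m => f m = g m) m ?_ h
  intro a b ha hb
  simp [ha, hb]

theorem ext_homog₂ {f g : M →ₗ[k] N →ₗ[k] P}
    (h : ∀ i j, ∀ m ∈ homog k (M := M) i, ∀ n ∈ homog k (M := N) j, f m n = g m n) : f = g :=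
  ext_homog fun i m hm => ext_homog fun j n hn => h i j m hm n hn

/-- Constructor for supermodule structures: the submodules `H 0` and `H 1` span, and they are
separated by a linear map. -/
abbrev superModuleOfProj (H : ZMod 2 → Submodule k P) (p : P →ₗ[k] Q)
    (h0 : ∀ m ∈ H 0, p m = 0 → m = 0) (h1 : ∀ m ∈ H 1, p m = 0)
    (hs : ∀ m, ∃ a ∈ H 0, ∃ b ∈ H 1, a + b = m) : SuperModule k P where
  homog := H
  isCompl := by
    constructor
    · rw [Submodule.disjoint_def]
      intro m hm hm'
      exact h0 m hm (h1 m hm')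
    · rw [codisjoint_iff, eq_top_iff]
      intro m _
      obtain ⟨a, ha, b, hb, rfl⟩ := hs m
      exact Submodule.add_mem_sup ha hb

/-- If `f : P → M` is injective and its image is stable under the projections of `M`, then `P`
is a supermodule with `P_i = f⁻¹(M_i)`. -/
abbrev superModuleOfInjective (f : P →ₗ[k] M) (hf : Function.Injective f)
    (h : ∀ (m : P) (i : ZMod 2), ∃ m', f m' = proj k i (f m)) : SuperModule k P :=
  superModuleOfProj (fun i => (homog k i).comap f) ((proj k 0).comp f)
    (fun m hm h0 => by
      apply hf
      rw [map_zero, ← h0]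
      exact (proj_of_mem hm).symm)
    (fun m hm => proj_of_mem_ne (k := k) (i := 0) (j := 1) hm (by decide))
    (fun m => by
      obtain ⟨a, ha⟩ := h m 0
      obtain ⟨b, hb⟩ := h m 1
      refine ⟨a, ?_, b, ?_, hf ?_⟩
      · rw [Submodule.mem_comap, ha]; exact proj_mem _ _
      · rw [Submodule.mem_comap, hb]; exact proj_mem _ _
      · rw [map_add, ha, hb, ← sum_zmod (fun i => proj k i (f m)), sum_proj])

end basics

/-- Products of supermodules, graded componentwise. -/
instance piSuperModule {k : Type u} [CommRing k] {ι : Type w} {M : ι → Type v}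
    [∀ i, AddCommGroup (M i)] [∀ i, Module k (M i)] [∀ i, SuperModule k (M i)] :
    SuperModule k (∀ i, M i) :=
  superModuleOfProj (fun e => Submodule.pi Set.univ fun i => homog k (M := M i) e)
    (LinearMap.pi fun i => (proj k 0).comp (LinearMap.proj i))
    (fun m hm h0 => by
      ext i
      rw [← proj_of_mem (hm i (Set.mem_univ i))]
      exact congrFun h0 i)
    (fun m hm => by
      ext i
      exact proj_of_mem_ne (hm i (Set.mem_univ i)) (by decide))
    (fun m => ⟨fun i => proj k 0 (m i), fun i _ => proj_mem _ _, fun i => proj k 1 (m i),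
      fun i _ => proj_mem _ _, by
        ext i
        rw [Pi.add_apply, ← sum_zmod (fun e => proj k e (m i)), sum_proj]⟩)

theorem mem_homog_pi {k : Type u} [CommRing k] {ι : Type w} {M : ι → Type v}
    [∀ i, AddCommGroup (M i)] [∀ i, Module k (M i)] [∀ i, SuperModule k (M i)]
    {e : ZMod 2} {m : ∀ i, M i} : m ∈ homog k e ↔ ∀ i, m i ∈ homog k e :=
  ⟨fun h i => h i (Set.mem_univ i), fun h i _ => h i⟩

section hom
variable {k : Type u} [CommRing k] {M : Type v} [AddCommGroup M] [Module k M] [SuperModule k M]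
  {N : Type w} [AddCommGroup N] [Module k N] [SuperModule k N]

/-- The homogeneous component of degree `e` of a linear map. -/
def homPart (e : ZMod 2) (f : M →ₗ[k] N) : M →ₗ[k] N :=
  ∑ j, (proj k (j + e)).comp (f.comp (proj k j))

theorem homPart_apply {e j : ZMod 2} (f : M →ₗ[k] N) {m : M} (hm : m ∈ homog k j) :
    homPart e f m = proj k (j + e) (f m) := by
  rw [homPart, LinearMap.sum_apply, Finset.sum_eq_single j]
  · simp [proj_of_mem hm]
  · intro i _ hi
    simp [proj_of_mem_ne hm hi.symm]
  · simp

theorem homPart_zero_add_one (f : M →ₗ[k] N) : homPart 0 f + homPart 1 f = f := by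
  refine ext_homog (k := k) fun j m hm => ?_
  rw [LinearMap.add_apply, homPart_apply f hm, homPart_apply f hm]
  conv_rhs => rw [← sum_proj (k := k) (f m), sum_zmod]
  rcases zmod_two j with rfl | rfl
  · simp
  · rw [add_comm]; rfl

/-- `Hom(M, N)` is a supermodule: a linear map has degree `e` if it maps `M_j` to `N_{j+e}`. -/
instance homSuperModule : SuperModule k (M →ₗ[k] N) where
  homog e :=
    { carrier := {f | ∀ j, ∀ m ∈ homog k (M := M) j, f m ∈ homog k (M := N) (j + e)}
      add_mem' := fun hf hg j m hm => Submodule.add_mem _ (hf j m hm) (hg j m hm)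
      zero_mem' := fun _ _ _ => Submodule.zero_mem _
      smul_mem' := fun c _ hf j m hm => Submodule.smul_mem _ c (hf j m hm) }
  isCompl := by
    constructor
    · rw [Submodule.disjoint_def]
      intro f h0 h1
      exact ext_homog (k := k) fun j m hm => eq_zero_of_mem (h0 j m hm) (h1 j m hm) (by simp)
    · rw [codisjoint_iff, eq_top_iff]
      intro f _
      rw [← homPart_zero_add_one f]
      refine Submodule.add_mem_sup ?_ ?_ <;>
      · intro j m hm
        rw [homPart_apply f hm]
        exact proj_mem _ _

theorem mem_homog_hom {e : ZMod 2} {f : M →ₗ[k] N} :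
    f ∈ homog k e ↔ ∀ j, ∀ m ∈ homog k (M := M) j, f m ∈ homog k (M := N) (j + e) := Iff.rfl

theorem homPart_mem (e : ZMod 2) (f : M →ₗ[k] N) : homPart e f ∈ homog k e := by
  intro j m hm
  rw [homPart_apply f hm]
  exact proj_mem _ _

theorem proj_hom (e : ZMod 2) (f : M →ₗ[k] N) : proj k e f = homPart e f := by
  conv_lhs => rw [← homPart_zero_add_one f]
  rw [map_add, proj_of_mem_ite (homPart_mem 0 f), proj_of_mem_ite (homPart_mem 1 f)]
  rcases zmod_two e with rfl | rfl <;> simp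

end hom

/-! ### Superalgebras and graded actions -/

/-- A `k`-superalgebra: a `k`-algebra with a supermodule structure for which the multiplication
is even. -/
class SuperAlgebra (k : Type u) (R : Type v) [CommRing k] [Ring R] [Algebra k R] extends
    SuperModule k R where
  one_mem : (1 : R) ∈ homog 0
  mul_mem : ∀ {i j : ZMod 2} {a b : R}, a ∈ homog i → b ∈ homog j → a * b ∈ homog (i + j)

/-- An `R`-module `M` over a superalgebra `R`, which is also a `k`-supermodule, is an
`R`-supermodule if `R_i M_j ⊆ M_{i+j}`. -/
class GradedAction (k : Type u) (R : Type v) (M : Type w) [CommRing k] [Ring R] [Algebra k R]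
    [SuperAlgebra k R] [AddCommGroup M] [Module k M] [Module R M] [SuperModule k M] : Prop where
  smul_mem : ∀ {i j : ZMod 2} {a : R} {m : M}, a ∈ homog k i → m ∈ homog k j →
    a • m ∈ homog k (i + j)

/-- The opposite algebra of a superalgebra, with the same grading (and no signs); a right
`A`-supermodule is a module over `Aᵐᵒᵖ` with graded action. -/
instance opSuperAlgebra {k : Type u} {A : Type v} [CommRing k] [Ring A] [Algebra k A]
    [SuperAlgebra k A] : SuperAlgebra k Aᵐᵒᵖ where
  toSuperModule := superModuleOfInjective (M := A) (MulOpposite.opLinearEquiv k).symm.toLinearMap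
    (MulOpposite.opLinearEquiv k).symm.injective (fun a i => ⟨MulOpposite.op (proj k i a.unop), rfl⟩)
  one_mem := SuperAlgebra.one_mem (k := k) (R := A)
  mul_mem := fun {i j a b} ha hb => by
    rw [add_comm]
    exact SuperAlgebra.mul_mem (k := k) (R := A) (a := b.unop) (b := a.unop) hb ha

theorem mem_homog_op {k : Type u} {A : Type v} [CommRing k] [Ring A] [Algebra k A]
    [SuperAlgebra k A] {i : ZMod 2} {a : Aᵐᵒᵖ} : a ∈ homog k i ↔ a.unop ∈ homog k i := Iff.rfl

theorem mul_mem_homog {k : Type u} {A : Type v} [CommRing k] [Ring A] [Algebra k A]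
    [SuperAlgebra k A] {i j : ZMod 2} {a b : A} (ha : a ∈ homog k i) (hb : b ∈ homog k j) :
    a * b ∈ homog k (i + j) := SuperAlgebra.mul_mem ha hb

section linhom
variable {k : Type u} [CommRing k] {R : Type v} [Ring R] [Algebra k R] [SuperAlgebra k R]
  {M : Type w} [AddCommGroup M] [Module k M] [Module R M] [IsScalarTower k R M]
  [SuperModule k M] [GradedAction k R M]
  {N : Type x} [AddCommGroup N] [Module k N] [Module R N] [IsScalarTower k R N]
  [SuperModule k N] [GradedAction k R N]

theorem proj_smul {i : ZMod 2} {r : R} (hr : r ∈ homog k i) (e : ZMod 2) (m : M) :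
    proj k (i + e) (r • m) = r • proj k e m := by
  refine homog_induction (k := k)
    (p := fun m => proj k (i + e) (r • m) = r • proj k e m) m ?_ ?_
  · intro a b ha hb
    simp only [smul_add, map_add, ha, hb]
  · intro j a ha
    rw [proj_of_mem_ite (GradedAction.smul_mem hr ha), proj_of_mem_ite ha]
    by_cases h : e = j <;> simp [h]

/-- The homogeneous component of degree `e` of a homomorphism of (right) supermodules. -/
def linPart (e : ZMod 2) (f : M →ₗ[R] N) : M →ₗ[R] N :=
  { homPart e (f.restrictScalars k) with
    map_smul' := fun r m => by
      change homPart e (f.restrictScalars k) (r • m) = r • homPart e (f.restrictScalars k) m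
      refine homog_induction (k := k) (p := fun r : R =>
        homPart e (f.restrictScalars k) (r • m) = r • homPart e (f.restrictScalars k) m) r ?_ ?_
      · intro a b ha hb
        simp only [add_smul, map_add, ha, hb]
      · intro i a ha
        refine homog_induction (k := k) (p := fun m =>
          homPart e (f.restrictScalars k) (a • m) = a • homPart e (f.restrictScalars k) m) m ?_ ?_
        · intro b c hb hc
          simp only [smul_add, map_add, hb, hc]
        · intro j b hb
          rw [homPart_apply _ hb, homPart_apply _ (GradedAction.smul_mem ha hb), add_assoc,
            ← proj_smul ha]
          simp }

end linhom

/-- `Hom_A(M, N)`, for right `A`-supermodules `M` and `N`, is a supermodule: a homomorphism has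
degree `e` if it maps `M_j` to `N_{j+e}`. -/
instance linHomSuperModule {k : Type u} [CommRing k] {A : Type v} [Ring A] [Algebra k A]
    [SuperAlgebra k A] {M : Type w} [AddCommGroup M] [Module k M] [Module Aᵐᵒᵖ M]
    [IsScalarTower k Aᵐᵒᵖ M] [SuperModule k M] [GradedAction k Aᵐᵒᵖ M]
    {N : Type x} [AddCommGroup N] [Module k N] [Module Aᵐᵒᵖ N] [IsScalarTower k Aᵐᵒᵖ N]
    [SuperModule k N] [GradedAction k Aᵐᵒᵖ N] : SuperModule k (M →ₗ[Aᵐᵒᵖ] N) :=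
  superModuleOfInjective (LinearMap.restrictScalarsₗ k Aᵐᵒᵖ M N k)
    (LinearMap.restrictScalars_injective k)
    (fun f e => ⟨linPart (k := k) e f, by rw [proj_hom]; rfl⟩)

theorem mem_homog_linHom {k : Type u} [CommRing k] {A : Type v} [Ring A] [Algebra k A]
    [SuperAlgebra k A] {M : Type w} [AddCommGroup M] [Module k M] [Module Aᵐᵒᵖ M]
    [IsScalarTower k Aᵐᵒᵖ M] [SuperModule k M] [GradedAction k Aᵐᵒᵖ M]
    {N : Type x} [AddCommGroup N] [Module k N] [Module Aᵐᵒᵖ N] [IsScalarTower k Aᵐᵒᵖ N]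
    [SuperModule k N] [GradedAction k Aᵐᵒᵖ N] {e : ZMod 2} {f : M →ₗ[Aᵐᵒᵖ] N} :
    f ∈ homog k e ↔ ∀ j, ∀ m ∈ homog k (M := M) j, f m ∈ homog k (M := N) (j + e) := Iff.rfl

/-- An `R`-supermodule `M` is projective if it is a projective object of the category of
`R`-supermodules and even homomorphisms: even homomorphisms out of `M` lift along surjective even
homomorphisms. -/
def IsSuperProjective (k : Type u) (R : Type v) (M : Type w) [CommRing k] [Ring R] [Algebra k R]
    [SuperAlgebra k R] [AddCommGroup M] [Module k M] [Module R M] [SuperModule k M] : Prop :=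
  ∀ (N P : Type x) [AddCommGroup N] [AddCommGroup P] [Module k N] [Module k P]
    [Module R N] [Module R P] [IsScalarTower k R N] [IsScalarTower k R P]
    [SuperModule k N] [SuperModule k P] [GradedAction k R N] [GradedAction k R P]
    (g : N →ₗ[R] P) (f : M →ₗ[R] P),
    (∀ i, ∀ n ∈ homog k (M := N) i, g n ∈ homog k i) →
    (∀ i, ∀ m ∈ homog k (M := M) i, f m ∈ homog k i) →
    Function.Surjective g →
    ∃ h : M →ₗ[R] N, (∀ i, ∀ m ∈ homog k (M := M) i, h m ∈ homog k i) ∧ g ∘ₗ h = f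


/-! ### Tensor powers -/

/-- The tensor power `M^{⊗d}`. -/
abbrev TPow (k : Type u) [CommRing k] (M : Type v) [AddCommGroup M] [Module k M] (d : ℕ) : Type _ :=
  ⨂[k] (_ : Fin d), M

section tensor
variable {k : Type u} [CommRing k] {d : ℕ}
  {M : Type v} [AddCommGroup M] [Module k M] [SuperModule k M]
  {N : Type w} [AddCommGroup N] [Module k N] [SuperModule k N]
  {P : Type x} [AddCommGroup P] [Module k P] [SuperModule k P]
  {Q : Type y} [AddCommGroup Q] [Module k Q]

/-- The projection of `M^{⊗d}` onto `M_{ε 1} ⊗ ⋯ ⊗ M_{ε d}`. -/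
def multiProj (k : Type u) [CommRing k] {d : ℕ} {M : Type v} [AddCommGroup M] [Module k M]
    [SuperModule k M] (ε : Fin d → ZMod 2) : TPow k M d →ₗ[k] TPow k M d :=
  PiTensorProduct.map fun i => proj k (ε i)

theorem multiProj_tprod {ε δ : Fin d → ZMod 2} {m : Fin d → M} (hm : ∀ i, m i ∈ homog k (δ i)) :
    multiProj k ε (PiTensorProduct.tprod k m) =
      if ε = δ then PiTensorProduct.tprod k m else 0 := by
  rw [multiProj, PiTensorProduct.map_tprod]
  split_ifs with h
  · subst h
    congr 1
    ext i
    exact proj_of_mem (hm i)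
  · obtain ⟨i, hi⟩ := Function.ne_iff.mp h
    exact (PiTensorProduct.tprod k).map_coord_zero i (proj_of_mem_ne (hm i) (Ne.symm hi))

theorem sum_multiProj (t : TPow k M d) : ∑ ε, multiProj k ε t = t := by
  rw [← LinearMap.sum_apply]
  conv_rhs => rw [← LinearMap.id_apply (R := k) t]
  congr 1
  ext m
  simp only [LinearMap.compMultilinearMap_apply, LinearMap.sum_apply, LinearMap.id_apply]
  conv_rhs =>
    rw [show m = fun i => ∑ j, proj k j (m i) from funext fun i => (sum_proj (m i)).symm]
  rw [MultilinearMap.map_sum]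
  simp [multiProj]

theorem ext_tensor {f g : TPow k M d →ₗ[k] Q}
    (h : ∀ (ε : Fin d → ZMod 2) (m : Fin d → M), (∀ i, m i ∈ homog k (ε i)) →
      f (PiTensorProduct.tprod k m) = g (PiTensorProduct.tprod k m)) : f = g := by
  ext m
  simp only [LinearMap.compMultilinearMap_apply]
  rw [← sum_multiProj (PiTensorProduct.tprod k m), map_sum, map_sum]
  refine Finset.sum_congr rfl fun ε _ => ?_
  rw [multiProj, PiTensorProduct.map_tprod]
  exact h ε _ fun i => proj_mem _ _

/-- `M^{⊗d}` is a supermodule: the degree of a tensor of homogeneous elements is the sum of the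
degrees. -/
instance tensorSuperModule : SuperModule k (TPow k M d) :=
  superModuleOfProj
    (fun e => Submodule.span k {t | ∃ (ε : Fin d → ZMod 2) (m : Fin d → M),
      (∀ i, m i ∈ homog k (ε i)) ∧ ∑ i, ε i = e ∧ t = PiTensorProduct.tprod k m})
    (∑ ε : Fin d → ZMod 2, if ∑ i, ε i = 0 then multiProj k ε else 0)
    (fun t ht h0 => by
      rw [← h0]
      clear h0
      induction ht using Submodule.span_induction with
      | mem t ht =>
        obtain ⟨ε, m, hm, he, rfl⟩ := ht
        rw [LinearMap.sum_apply, Finset.sum_eq_single ε]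
        · rw [if_pos he, multiProj_tprod hm, if_pos rfl]
        · intro δ _ hδ
          split_ifs with h
          · rw [multiProj_tprod hm, if_neg hδ]
          · rfl
        · simp
      | zero => simp
      | add a b _ _ ha hb => rw [map_add, ← ha, ← hb]
      | smul c a _ ha => rw [map_smul, ← ha])
    (fun t ht => by
      induction ht using Submodule.span_induction with
      | mem t ht =>
        obtain ⟨ε, m, hm, he, rfl⟩ := ht
        rw [LinearMap.sum_apply]
        refine Finset.sum_eq_zero fun δ _ => ?_
        split_ifs with h
        · rw [multiProj_tprod hm, if_neg]
          rintro rfl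
          rw [he] at h
          exact absurd h (by decide)
        · rfl
      | zero => simp
      | add a b _ _ ha hb => rw [map_add, ha, hb, add_zero]
      | smul c a _ ha => rw [map_smul, ha, smul_zero])
    (fun t => by
      induction t using PiTensorProduct.induction_on with
      | smul_tprod r m =>
        rw [← sum_multiProj (PiTensorProduct.tprod k m), ← Finset.sum_filter_add_sum_filter_not
          (p := fun ε : Fin d → ZMod 2 => ∑ i, ε i = 0), smul_add]
        refine ⟨_, ?_, _, ?_, rfl⟩
        · refine Submodule.smul_mem _ _ (Submodule.sum_mem _ fun ε hε => Submodule.subset_span ?_)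
          rw [multiProj, PiTensorProduct.map_tprod]
          exact ⟨ε, _, fun i => proj_mem _ _, (Finset.mem_filter.mp hε).2, rfl⟩
        · refine Submodule.smul_mem _ _ (Submodule.sum_mem _ fun ε hε => Submodule.subset_span ?_)
          rw [multiProj, PiTensorProduct.map_tprod]
          exact ⟨ε, _, fun i => proj_mem _ _,
            (zmod_two _).resolve_left (Finset.mem_filter.mp hε).2, rfl⟩
      | add s t hs ht =>
        obtain ⟨a, ha, b, hb, rfl⟩ := hs
        obtain ⟨a', ha', b', hb', rfl⟩ := ht
        exact ⟨a + a', Submodule.add_mem _ ha ha', b + b', Submodule.add_mem _ hb hb', by abel⟩)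

theorem tprod_mem {ε : Fin d → ZMod 2} {m : Fin d → M} (hm : ∀ i, m i ∈ homog k (ε i)) :
    PiTensorProduct.tprod k m ∈ homog k (∑ i, ε i) :=
  Submodule.subset_span ⟨ε, m, hm, rfl, rfl⟩

/-- To check that a linear map sends homogeneous tensors into given submodules, it suffices to
check it on pure tensors of homogeneous elements. -/
theorem tensor_homog_induction {e : ZMod 2} {t : TPow k M d} (ht : t ∈ homog k e)
    (S : Submodule k Q) (f : TPow k M d →ₗ[k] Q)
    (h : ∀ (ε : Fin d → ZMod 2) (m : Fin d → M), (∀ i, m i ∈ homog k (ε i)) → ∑ i, ε i = e →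
      f (PiTensorProduct.tprod k m) ∈ S) : f t ∈ S := by
  change t ∈ S.comap f
  refine (Submodule.span_le.mpr ?_ : _ ≤ S.comap f) ht
  rintro _ ⟨ε, m, hm, he, rfl⟩
  exact h ε m hm he

/-! ### The signed action of the symmetric group -/

/-- The exponent of the sign arising when `v_1 ⊗ ⋯ ⊗ v_d`, with `v_i` of degree `ε i`, is permuted
to `v_{σ 1} ⊗ ⋯ ⊗ v_{σ d}`: the sum of `ε (σ i) * ε (σ j)` over the inversions of `σ`. -/
def permSign (σ : Equiv.Perm (Fin d)) (ε : Fin d → ZMod 2) : ZMod 2 :=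
  ∑ i, ∑ j, if i < j ∧ σ j < σ i then ε (σ i) * ε (σ j) else 0

/-- The right action of the symmetric group on `M^{⊗d}` by signed permutations: for homogeneous
elements, `(v_1 ⊗ ⋯ ⊗ v_d).σ = ± v_{σ 1} ⊗ ⋯ ⊗ v_{σ d}`, where each transposition of neighbours
`v_i`, `v_j` contributes the sign `(-1)^{|v_i| |v_j|}`. -/
def permAct (σ : Equiv.Perm (Fin d)) : TPow k M d →ₗ[k] TPow k M d :=
  ∑ ε : Fin d → ZMod 2, sgn k (permSign σ ε) •
    (PiTensorProduct.reindex k (fun _ => M) σ.symm).toLinearMap.comp (multiProj k ε)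

theorem permAct_tprod (σ : Equiv.Perm (Fin d)) {ε : Fin d → ZMod 2} {m : Fin d → M}
    (hm : ∀ i, m i ∈ homog k (ε i)) :
    permAct σ (PiTensorProduct.tprod k m) =
      sgn k (permSign σ ε) • PiTensorProduct.tprod k fun i => m (σ i) := by
  rw [permAct, LinearMap.sum_apply, Finset.sum_eq_single ε]
  · rw [LinearMap.smul_apply, LinearMap.comp_apply, multiProj_tprod hm, if_pos rfl]
    congr 1
    exact PiTensorProduct.reindex_tprod _ _
  · intro δ _ hδ
    rw [LinearMap.smul_apply, LinearMap.comp_apply, multiProj_tprod hm, if_neg hδ]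
    simp
  · simp

theorem permAct_mem (σ : Equiv.Perm (Fin d)) {e : ZMod 2} {t : TPow k M d}
    (ht : t ∈ homog k e) : permAct σ t ∈ homog k e := by
  refine tensor_homog_induction ht _ (permAct σ) fun ε m hm he => ?_
  rw [permAct_tprod σ hm]
  refine Submodule.smul_mem _ _ ?_
  rw [← he, ← Equiv.sum_comp σ ε]
  exact tprod_mem fun i => hm (σ i)

theorem permAct_proj (σ : Equiv.Perm (Fin d)) (e : ZMod 2) (t : TPow k M d) :
    permAct σ (proj k e t) = proj k e (permAct σ t) := by
  refine homog_induction (k := k)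
    (p := fun t : TPow k M d => permAct σ (proj k e t) = proj k e (permAct σ t)) t ?_ ?_
  · intro a b ha hb
    simp only [map_add, ha, hb]
  · intro i a ha
    rw [proj_of_mem_ite ha, proj_of_mem_ite (permAct_mem σ ha)]
    split_ifs <;> simp

theorem permAct_one (t : TPow k M d) : permAct (1 : Equiv.Perm (Fin d)) t = t := by
  have : permAct (1 : Equiv.Perm (Fin d)) = LinearMap.id (R := k) (M := TPow k M d) := by
    refine ext_tensor fun ε m hm => ?_
    rw [permAct_tprod _ hm]
    have : permSign (1 : Equiv.Perm (Fin d)) ε = 0 :=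
      Finset.sum_eq_zero fun i _ => Finset.sum_eq_zero fun j _ =>
        if_neg fun h => lt_asymm h.1 h.2
    simp [this, sgn_zero]
  rw [this]
  rfl

theorem permSign_mul (σ τ : Equiv.Perm (Fin d)) (ε : Fin d → ZMod 2) :
    permSign (σ * τ) ε = permSign σ ε + permSign τ (fun i => ε (σ i)) := by
  have key : ∀ a b : Fin d, a < b →
      ((if τ b < τ a then ε (σ (τ a)) * ε (σ (τ b)) else 0) +
        (if (τ a < τ b ∧ σ (τ b) < σ (τ a)) ∨ (τ b < τ a ∧ σ (τ a) < σ (τ b)) then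
          ε (σ (τ a)) * ε (σ (τ b)) else 0) : ZMod 2) =
        if σ (τ b) < σ (τ a) then ε (σ (τ a)) * ε (σ (τ b)) else 0 := by
    intro a b hab
    have h2 : ∀ e : ZMod 2, e + e = 0 := by decide
    have h1 : τ a ≠ τ b := fun h => hab.ne (τ.injective h)
    have h3 : σ (τ a) ≠ σ (τ b) := fun h => h1 (σ.injective h)
    rcases lt_or_gt_of_ne h1 with h | h <;> rcases lt_or_gt_of_ne h3 with h' | h' <;>
      simp [h, h', h.not_gt, h'.not_gt, h2]
  have hσ : permSign σ ε = ∑ a, ∑ b, if a < b then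
      (if (τ a < τ b ∧ σ (τ b) < σ (τ a)) ∨ (τ b < τ a ∧ σ (τ a) < σ (τ b)) then
          ε (σ (τ a)) * ε (σ (τ b)) else 0) else 0 := by
    have e1 : permSign σ ε = ∑ a, ∑ b, if τ a < τ b ∧ σ (τ b) < σ (τ a) then
        ε (σ (τ a)) * ε (σ (τ b)) else 0 := by
      rw [permSign, ← Equiv.sum_comp τ]
      exact Finset.sum_congr rfl fun a _ => (Equiv.sum_comp τ _).symm
    have e2 : ∀ a b, (if τ a < τ b ∧ σ (τ b) < σ (τ a) then
        ε (σ (τ a)) * ε (σ (τ b)) else 0 : ZMod 2) =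
        (if a < b then (if τ a < τ b ∧ σ (τ b) < σ (τ a) then
          ε (σ (τ a)) * ε (σ (τ b)) else 0) else 0) +
        (if b < a then (if τ a < τ b ∧ σ (τ b) < σ (τ a) then
          ε (σ (τ a)) * ε (σ (τ b)) else 0) else 0) := by
      intro a b
      rcases lt_trichotomy a b with h | h | h
      · simp [h, h.not_gt]
      · subst h; simp
      · simp [h, h.not_gt]
    rw [e1, Finset.sum_congr rfl fun a _ => Finset.sum_congr rfl fun b _ => e2 a b]
    simp only [Finset.sum_add_distrib]
    conv_lhs => enter [2]; rw [Finset.sum_comm]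
    rw [← Finset.sum_add_distrib]
    refine Finset.sum_congr rfl fun a _ => ?_
    rw [← Finset.sum_add_distrib]
    refine Finset.sum_congr rfl fun b _ => ?_
    by_cases hab : a < b
    · simp only [hab, if_true]
      rcases lt_trichotomy (τ a) (τ b) with h | h | h
      · simp [h, h.not_gt]
      · simp [h]
      · rw [mul_comm (ε (σ (τ b)))]
        simp [h, h.not_gt]
    · simp [hab]
  rw [hσ, permSign, permSign, ← Finset.sum_add_distrib]
  refine Finset.sum_congr rfl fun a _ => ?_
  rw [← Finset.sum_add_distrib]
  refine Finset.sum_congr rfl fun b _ => ?_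
  by_cases hab : a < b
  · simp only [hab, true_and, if_true, Equiv.Perm.mul_apply]
    rw [add_comm, key a b hab]
  · simp [hab]

theorem permAct_mul (σ τ : Equiv.Perm (Fin d)) (t : TPow k M d) :
    permAct (σ * τ) t = permAct τ (permAct σ t) := by
  have : permAct (σ * τ) = (permAct τ).comp (permAct (k := k) (M := M) σ) := by
    refine ext_tensor fun ε m hm => ?_
    rw [LinearMap.comp_apply, permAct_tprod _ hm, permAct_tprod _ hm, map_smul,
      permAct_tprod τ (ε := fun i => ε (σ i)) (fun i => hm (σ i)), smul_smul, ← sgn_add,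
      permSign_mul]
    rfl
  rw [this]
  rfl

/-! ### Tensor powers of bilinear maps -/

/-- The exponent of the sign arising when `(a_1 ⊗ ⋯ ⊗ a_d) ⊗ (b_1 ⊗ ⋯ ⊗ b_d)` is rearranged to
`(a_1 ⊗ b_1) ⊗ ⋯ ⊗ (a_d ⊗ b_d)`, for `a_i` of degree `ε i` and `b_i` of degree `δ i`. -/
def shuffleSign (ε δ : Fin d → ZMod 2) : ZMod 2 :=
  ∑ i, ∑ j, if j < i then ε i * δ j else 0

/-- The `d`-th tensor power of a bilinear map `μ`, with the rule of signs: for homogeneous elements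
`(a_1 ⊗ ⋯ ⊗ a_d, b_1 ⊗ ⋯ ⊗ b_d) ↦ (-1)^{∑_{j < i} |a_i| |b_j|} μ(a_1, b_1) ⊗ ⋯ ⊗ μ(a_d, b_d)`. -/
def tensorMap₂ (d : ℕ) (μ : M →ₗ[k] N →ₗ[k] P) :
    TPow k M d →ₗ[k] TPow k N d →ₗ[k] TPow k P d :=
  ∑ ε : Fin d → ZMod 2, ∑ δ : Fin d → ZMod 2, sgn k (shuffleSign ε δ) •
    (PiTensorProduct.map₂ fun _ => μ).compl₁₂ (multiProj k ε) (multiProj k δ)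

theorem tensorMap₂_tprod (μ : M →ₗ[k] N →ₗ[k] P) {ε δ : Fin d → ZMod 2} {m : Fin d → M}
    {n : Fin d → N} (hm : ∀ i, m i ∈ homog k (ε i)) (hn : ∀ i, n i ∈ homog k (δ i)) :
    tensorMap₂ d μ (PiTensorProduct.tprod k m) (PiTensorProduct.tprod k n) =
      sgn k (shuffleSign ε δ) • PiTensorProduct.tprod k fun i => μ (m i) (n i) := by
  simp only [tensorMap₂, LinearMap.sum_apply, LinearMap.smul_apply, LinearMap.compl₁₂_apply]
  rw [Finset.sum_eq_single ε]
  · rw [Finset.sum_eq_single δ]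
    · rw [multiProj_tprod hm, multiProj_tprod hn, if_pos rfl, if_pos rfl,
        PiTensorProduct.map₂_tprod_tprod]
    · intro δ' _ h
      rw [multiProj_tprod hn, if_neg h]
      simp
    · simp
  · intro ε' _ h
    refine Finset.sum_eq_zero fun δ' _ => ?_
    rw [multiProj_tprod hm, if_neg h]
    simp
  · simp

theorem ext_tensor₂ {f g : TPow k M d →ₗ[k] TPow k N d →ₗ[k] Q}
    (h : ∀ (ε : Fin d → ZMod 2) (m : Fin d → M) (δ : Fin d → ZMod 2) (n : Fin d → N),
      (∀ i, m i ∈ homog k (ε i)) → (∀ i, n i ∈ homog k (δ i)) →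
      f (PiTensorProduct.tprod k m) (PiTensorProduct.tprod k n) =
        g (PiTensorProduct.tprod k m) (PiTensorProduct.tprod k n)) : f = g :=
  ext_tensor fun ε m hm => ext_tensor fun δ n hn => h ε m δ n hm hn

/-- A bilinear map is even if it adds degrees. -/
def IsEven₂ (μ : M →ₗ[k] N →ₗ[k] P) : Prop :=
  ∀ (i j : ZMod 2), ∀ m ∈ homog k (M := M) i, ∀ n ∈ homog k (M := N) j,
    μ m n ∈ homog k (M := P) (i + j)

theorem tensorMap₂_mem {μ : M →ₗ[k] N →ₗ[k] P} (hμ : IsEven₂ μ) : IsEven₂ (tensorMap₂ d μ) := by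
  intro i j s hs t ht
  refine tensor_homog_induction (Q := TPow k P d) hs _ ((tensorMap₂ d μ).flip t)
    fun ε m hm he => ?_
  refine tensor_homog_induction ht _ (tensorMap₂ d μ (PiTensorProduct.tprod k m))
    fun δ n hn hd => ?_
  rw [tensorMap₂_tprod μ hm hn, ← he, ← hd, ← Finset.sum_add_distrib]
  exact Submodule.smul_mem _ _ (tprod_mem fun i => hμ _ _ _ (hm i) _ (hn i))

theorem shuffleSign_perm (σ : Equiv.Perm (Fin d)) (ε δ : Fin d → ZMod 2) :
    shuffleSign ε δ + permSign σ (fun i => ε i + δ i) =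
      permSign σ ε + permSign σ δ + shuffleSign (fun i => ε (σ i)) (fun i => δ (σ i)) := by
  have h2 : ∀ e : ZMod 2, e + e = 0 := by decide
  have e1 : shuffleSign ε δ = ∑ i, ∑ j, if σ j < σ i then ε (σ i) * δ (σ j) else 0 := by
    rw [shuffleSign, ← Equiv.sum_comp σ]
    exact Finset.sum_congr rfl fun a _ => (Equiv.sum_comp σ _).symm
  have e2 : permSign σ (fun i => ε i + δ i) = permSign σ ε + permSign σ δ +
      ∑ i, ∑ j, ((if i < j ∧ σ j < σ i then ε (σ i) * δ (σ j) else 0) +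
        (if j < i ∧ σ i < σ j then ε (σ i) * δ (σ j) else 0)) := by
    have e3 : ∑ i, ∑ j, (if j < i ∧ σ i < σ j then ε (σ i) * δ (σ j) else 0) =
        ∑ i, ∑ j, (if i < j ∧ σ j < σ i then ε (σ j) * δ (σ i) else 0) := Finset.sum_comm
    simp_rw [Finset.sum_add_distrib]
    rw [e3]
    simp_rw [permSign, ← Finset.sum_add_distrib]
    refine Finset.sum_congr rfl fun i _ => Finset.sum_congr rfl fun j _ => ?_
    split_ifs
    · ring
    · simp
  rw [e1, e2, shuffleSign, add_comm, add_assoc]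
  congr 1
  simp_rw [← Finset.sum_add_distrib]
  refine Finset.sum_congr rfl fun i _ => Finset.sum_congr rfl fun j _ => ?_
  rcases lt_trichotomy i j with h | h | h
  · simp [h, h.not_gt, h2]
  · subst h; simp
  · have : σ i ≠ σ j := fun h' => h.ne' (σ.injective h')
    rcases lt_or_gt_of_ne this with h' | h' <;> simp [h, h', h.not_gt, h'.not_gt]

theorem permAct_tensorMap₂ (σ : Equiv.Perm (Fin d)) {μ : M →ₗ[k] N →ₗ[k] P} (hμ : IsEven₂ μ)
    (s : TPow k M d) (t : TPow k N d) :
    permAct σ (tensorMap₂ d μ s t) = tensorMap₂ d μ (permAct σ s) (permAct σ t) := by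
  have : (tensorMap₂ d μ).compr₂ (permAct σ) =
      (tensorMap₂ d μ).compl₁₂ (permAct σ) (permAct σ) := by
    refine ext_tensor₂ fun ε m δ n hm hn => ?_
    rw [LinearMap.compr₂_apply, LinearMap.compl₁₂_apply, tensorMap₂_tprod μ hm hn, map_smul,
      permAct_tprod σ hm, permAct_tprod σ hn,
      permAct_tprod σ (ε := fun i => ε i + δ i) fun i => hμ _ _ _ (hm i) _ (hn i),
      LinearMap.map_smul₂, map_smul,
      tensorMap₂_tprod μ (ε := fun i => ε (σ i)) (δ := fun i => δ (σ i)) (fun i => hm (σ i))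
        (fun i => hn (σ i)), smul_smul, smul_smul, smul_smul, ← sgn_add, ← sgn_add, ← sgn_add,
      shuffleSign_perm, add_assoc]
  exact LinearMap.congr_fun₂ this s t

theorem shuffleSign_add_left (ε ε' δ : Fin d → ZMod 2) :
    shuffleSign (fun i => ε i + ε' i) δ = shuffleSign ε δ + shuffleSign ε' δ := by
  simp_rw [shuffleSign, ← Finset.sum_add_distrib]
  refine Finset.sum_congr rfl fun i _ => Finset.sum_congr rfl fun j _ => ?_
  split_ifs <;> simp [add_mul]

theorem shuffleSign_add_right (ε δ δ' : Fin d → ZMod 2) :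
    shuffleSign ε (fun i => δ i + δ' i) = shuffleSign ε δ + shuffleSign ε δ' := by
  simp_rw [shuffleSign, ← Finset.sum_add_distrib]
  refine Finset.sum_congr rfl fun i _ => Finset.sum_congr rfl fun j _ => ?_
  split_ifs <;> simp [mul_add]

end tensor

/-- Associativity passes to tensor powers of bilinear maps. -/
theorem tensorMap₂_assoc {k : Type u} [CommRing k] {d : ℕ}
    {M₁ M₂ M₃ M₁₂ M₂₃ M : Type*} [AddCommGroup M₁] [Module k M₁] [SuperModule k M₁]
    [AddCommGroup M₂] [Module k M₂] [SuperModule k M₂]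
    [AddCommGroup M₃] [Module k M₃] [SuperModule k M₃]
    [AddCommGroup M₁₂] [Module k M₁₂] [SuperModule k M₁₂]
    [AddCommGroup M₂₃] [Module k M₂₃] [SuperModule k M₂₃]
    [AddCommGroup M] [Module k M] [SuperModule k M]
    {μ : M₁ →ₗ[k] M₂ →ₗ[k] M₁₂} {ν : M₁₂ →ₗ[k] M₃ →ₗ[k] M}
    {μ' : M₂ →ₗ[k] M₃ →ₗ[k] M₂₃} {ν' : M₁ →ₗ[k] M₂₃ →ₗ[k] M}
    (hμ : IsEven₂ μ) (hμ' : IsEven₂ μ')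
    (h : ∀ a b c, ν (μ a b) c = ν' a (μ' b c))
    (a : TPow k M₁ d) (b : TPow k M₂ d) (c : TPow k M₃ d) :
    tensorMap₂ d ν (tensorMap₂ d μ a b) c = tensorMap₂ d ν' a (tensorMap₂ d μ' b c) := by
  refine LinearMap.congr_fun (f := ((tensorMap₂ d ν).flip c) ∘ₗ ((tensorMap₂ d μ).flip b))
    (g := (tensorMap₂ d ν').flip (tensorMap₂ d μ' b c)) (ext_tensor fun ε x hx => ?_) a
  refine LinearMap.congr_fun
    (f := ((tensorMap₂ d ν).flip c) ∘ₗ (tensorMap₂ d μ (PiTensorProduct.tprod k x)))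
    (g := (tensorMap₂ d ν' (PiTensorProduct.tprod k x)) ∘ₗ ((tensorMap₂ d μ').flip c))
    (ext_tensor fun δ y hy => ?_) b
  refine LinearMap.congr_fun
    (f := tensorMap₂ d ν (tensorMap₂ d μ (PiTensorProduct.tprod k x) (PiTensorProduct.tprod k y)))
    (g := (tensorMap₂ d ν' (PiTensorProduct.tprod k x)) ∘ₗ
      (tensorMap₂ d μ' (PiTensorProduct.tprod k y)))
    (ext_tensor fun η z hz => ?_) c
  rw [LinearMap.comp_apply, tensorMap₂_tprod μ hx hy, tensorMap₂_tprod μ' hy hz,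
    LinearMap.map_smul₂, map_smul,
    tensorMap₂_tprod ν (ε := fun i => ε i + δ i) (fun i => hμ _ _ _ (hx i) _ (hy i)) hz,
    tensorMap₂_tprod ν' (δ := fun i => δ i + η i) hx (fun i => hμ' _ _ _ (hy i) _ (hz i)),
    smul_smul, smul_smul, ← sgn_add, ← sgn_add, shuffleSign_add_left, shuffleSign_add_right]
  simp_rw [h]
  congr 2
  ring

/-! ### Divided powers -/

/-- The divided power `Γ^d M = (M^{⊗d})^{𝔖_d}`. -/
def divPow (k : Type u) [CommRing k] (M : Type v) [AddCommGroup M] [Module k M] [SuperModule k M]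
    (d : ℕ) : Submodule k (TPow k M d) where
  carrier := {t | ∀ σ : Equiv.Perm (Fin d), permAct σ t = t}
  add_mem' := fun ha hb σ => by rw [map_add, ha σ, hb σ]
  zero_mem' := fun σ => map_zero _
  smul_mem' := fun c a ha σ => by rw [map_smul, ha σ]

instance divPowSuperModule {k : Type u} [CommRing k] {M : Type v} [AddCommGroup M] [Module k M]
    [SuperModule k M] {d : ℕ} : SuperModule k (divPow k M d) :=
  superModuleOfInjective (divPow k M d).subtype (divPow k M d).injective_subtype
    (fun t e => ⟨⟨proj k e t.1, fun σ => by rw [permAct_proj, t.2 σ]⟩, rfl⟩)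

/-! ### The rule of signs for bilinear maps and the super-opposite algebra -/

section twist
variable {k : Type u} [CommRing k] {M : Type v} [AddCommGroup M] [Module k M] [SuperModule k M]
  {N : Type w} [AddCommGroup N] [Module k N] [SuperModule k N]
  {P : Type x} [AddCommGroup P] [Module k P]

/-- The bilinear map `(m, n) ↦ (-1)^{|m| |n|} μ(m, n)` (for homogeneous `m` and `n`). -/
def superTwist (μ : M →ₗ[k] N →ₗ[k] P) : M →ₗ[k] N →ₗ[k] P :=
  ∑ i : ZMod 2, ∑ j : ZMod 2, sgn k (i * j) • μ.compl₁₂ (proj k i) (proj k j)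

theorem superTwist_apply (μ : M →ₗ[k] N →ₗ[k] P) {i j : ZMod 2} {m : M} {n : N}
    (hm : m ∈ homog k i) (hn : n ∈ homog k j) :
    superTwist μ m n = sgn k (i * j) • μ m n := by
  simp only [superTwist, LinearMap.sum_apply, LinearMap.smul_apply, LinearMap.compl₁₂_apply,
    proj_of_mem_ite hm, proj_of_mem_ite hn]
  rw [Finset.sum_eq_single i, Finset.sum_eq_single j]
  · simp
  · intro j' _ h
    simp [h]
  · simp
  · intro i' _ h
    simp [h]
  · simp

end twist

theorem superTwist_mem {k : Type u} [CommRing k] {M : Type v} [AddCommGroup M] [Module k M]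
    [SuperModule k M] {N : Type w} [AddCommGroup N] [Module k N] [SuperModule k N]
    {P : Type x} [AddCommGroup P] [Module k P] [SuperModule k P] {μ : N →ₗ[k] M →ₗ[k] P}
    (hμ : IsEven₂ μ) : IsEven₂ (superTwist μ.flip) := by
  intro i j m hm n hn
  rw [superTwist_apply _ hm hn, add_comm, LinearMap.flip_apply]
  exact Submodule.smul_mem _ _ (hμ _ _ _ hn _ hm)

/-- A right action `ν` of an algebra with multiplication `μ` gives, by the rule of signs, a left
action of the super-opposite algebra. -/
theorem superTwist_assoc {k : Type u} [CommRing k] {M : Type v} [AddCommGroup M] [Module k M]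
    [SuperModule k M] {N : Type w} [AddCommGroup N] [Module k N] [SuperModule k N]
    {μ : M →ₗ[k] M →ₗ[k] M} {ν : N →ₗ[k] M →ₗ[k] N} (hμ : IsEven₂ μ) (hν : IsEven₂ ν)
    (h : ∀ n a b, ν (ν n a) b = ν n (μ a b)) (a b : M) (c : N) :
    superTwist ν.flip (superTwist μ.flip a b) c =
      superTwist ν.flip a (superTwist ν.flip b c) := by
  refine LinearMap.congr_fun (f := ((superTwist ν.flip).flip c) ∘ₗ ((superTwist μ.flip).flip b))
    (g := (superTwist ν.flip).flip (superTwist ν.flip b c)) (ext_homog fun i x hx => ?_) a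
  refine LinearMap.congr_fun
    (f := ((superTwist ν.flip).flip c) ∘ₗ (superTwist μ.flip x))
    (g := (superTwist ν.flip x) ∘ₗ ((superTwist ν.flip).flip c)) (ext_homog fun j y hy => ?_) b
  refine LinearMap.congr_fun
    (f := superTwist ν.flip (superTwist μ.flip x y))
    (g := (superTwist ν.flip x) ∘ₗ (superTwist ν.flip y)) (ext_homog fun l z hz => ?_) c
  rw [LinearMap.comp_apply, superTwist_apply _ (superTwist_mem hμ _ _ _ hx _ hy) hz,
    superTwist_apply _ hx (superTwist_mem hν _ _ _ hy _ hz), superTwist_apply _ hx hy,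
    superTwist_apply _ hy hz]
  simp only [LinearMap.flip_apply, map_smul, LinearMap.smul_apply, h, smul_smul, ← sgn_add]
  congr 2
  ring

theorem superTwist_one {k : Type u} [CommRing k] {M : Type v} [AddCommGroup M] [Module k M]
    [SuperModule k M] {N : Type w} [AddCommGroup N] [Module k N] [SuperModule k N]
    {ν : N →ₗ[k] M →ₗ[k] N} {e : M} (he : e ∈ homog k 0) (h : ∀ n, ν n e = n) (n : N) :
    superTwist ν.flip e n = n := by
  refine LinearMap.congr_fun (f := superTwist ν.flip e) (g := LinearMap.id)
    (ext_homog fun i x hx => ?_) n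
  rw [superTwist_apply _ he hx]
  simp [sgn_zero, h]

theorem superTwist_one' {k : Type u} [CommRing k] {M : Type v} [AddCommGroup M] [Module k M]
    [SuperModule k M] {N : Type w} [AddCommGroup N] [Module k N] [SuperModule k N]
    {ν : M →ₗ[k] N →ₗ[k] N} {e : M} (he : e ∈ homog k 0) (h : ∀ n, ν e n = n) (n : N) :
    superTwist ν.flip n e = n := by
  refine LinearMap.congr_fun (f := (superTwist ν.flip).flip e) (g := LinearMap.id)
    (ext_homog fun i x hx => ?_) n
  rw [LinearMap.flip_apply, superTwist_apply _ hx he]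
  simp [sgn_zero, h]

section sop
variable {k : Type u} [CommRing k] {R : Type v} [Ring R] [Algebra k R] [SuperAlgebra k R]

/-- The multiplication of a superalgebra as a bilinear map. -/
def mulMap (k : Type u) [CommRing k] (R : Type v) [Ring R] [Algebra k R] :
    R →ₗ[k] R →ₗ[k] R := LinearMap.mul k R

theorem mulMap_even : IsEven₂ (mulMap k R) := fun _ _ _ ha _ hb => mul_mem_homog ha hb

/-- The bilinear map `(a, b) ↦ (-1)^{|a| |b|} b a` (for homogeneous `a` and `b`). -/
def superOpMul (k : Type u) [CommRing k] {R : Type v} [Ring R] [Algebra k R] [SuperAlgebra k R] :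
    R →ₗ[k] R →ₗ[k] R := superTwist (mulMap k R).flip

theorem superOpMul_apply {i j : ZMod 2} {a b : R} (ha : a ∈ homog k i) (hb : b ∈ homog k j) :
    superOpMul k a b = sgn k (i * j) • (b * a) :=
  superTwist_apply (mulMap k R).flip ha hb

end sop

/-- The super-opposite `R^{sop}` of a superalgebra `R`: the same supermodule and unit, with
multiplication `a · b = (-1)^{|a| |b|} b a` for homogeneous `a` and `b`. -/
def SuperOpposite (_k : Type u) (R : Type v) : Type v := R

namespace SuperOpposite
variable {k : Type u} [CommRing k] {R : Type v} [Ring R] [Algebra k R] [SuperAlgebra k R]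

/-- The identity map, as a map to the super-opposite. -/
def op (a : R) : SuperOpposite k R := a

/-- The identity map, as a map from the super-opposite. -/
def unop (a : SuperOpposite k R) : R := a

instance instAddCommGroup : AddCommGroup (SuperOpposite k R) := inferInstanceAs (AddCommGroup R)
instance instModule : Module k (SuperOpposite k R) := inferInstanceAs (Module k R)

instance instRing : Ring (SuperOpposite k R) where
  __ := instAddCommGroup
  mul := fun a b => op (superOpMul k a.unop b.unop)
  one := op 1
  mul_assoc := superTwist_assoc (M := R) (N := R) (mulMap_even (k := k) (R := R))
    (mulMap_even (k := k) (R := R)) (mul_assoc (G := R))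
  one_mul := superTwist_one (k := k) (M := R) (N := R) (ν := mulMap k R)
    (SuperAlgebra.one_mem (k := k) (R := R)) (mul_one (M := R))
  mul_one := superTwist_one' (k := k) (M := R) (N := R) (ν := mulMap k R)
    (SuperAlgebra.one_mem (k := k) (R := R)) (one_mul (M := R))
  left_distrib := fun a b c => map_add (superOpMul k a.unop) b.unop c.unop
  right_distrib := fun a b c => LinearMap.map_add₂ (superOpMul k) a.unop b.unop c.unop
  zero_mul := fun a => LinearMap.map_zero₂ (superOpMul k) a.unop
  mul_zero := fun a => map_zero (superOpMul k a.unop)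

instance instAlgebra : Algebra k (SuperOpposite k R) :=
  Algebra.ofModule (fun r a b => LinearMap.map_smul₂ (superOpMul k) r a.unop b.unop)
    (fun r a b => map_smul (superOpMul k a.unop) r b.unop)

instance instSuperAlgebra : SuperAlgebra k (SuperOpposite k R) where
  toSuperModule := (SuperAlgebra.toSuperModule : SuperModule k R)
  one_mem := SuperAlgebra.one_mem (k := k) (R := R)
  mul_mem := fun {i j} {a b} ha hb =>
    superTwist_mem (mulMap_even (k := k) (R := R)) i j a.unop ha b.unop hb

end SuperOpposite

/-! ### Categories enriched in supermodules -/

/-- A category enriched in `k`-supermodules and even maps: composition is bilinear and even. -/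
structure SuperCat (k : Type u) [CommRing k] where
  Obj : Type w
  Hom : Obj → Obj → Type v
  [addCommGroup : ∀ X Y, AddCommGroup (Hom X Y)]
  [module : ∀ X Y, Module k (Hom X Y)]
  [superModule : ∀ X Y, SuperModule k (Hom X Y)]
  id : ∀ X, Hom X X
  comp : ∀ {X Y Z}, Hom Y Z →ₗ[k] Hom X Y →ₗ[k] Hom X Z
  id_mem : ∀ X, id X ∈ homog k 0
  comp_mem : ∀ {X Y Z}, IsEven₂ (comp (X := X) (Y := Y) (Z := Z))
  id_comp : ∀ {X Y} (f : Hom X Y), comp (id Y) f = f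
  comp_id : ∀ {X Y} (f : Hom X Y), comp f (id X) = f
  assoc : ∀ {W X Y Z} (h : Hom Y Z) (g : Hom X Y) (f : Hom W X),
    comp (comp h g) f = comp h (comp g f)

attribute [instance] SuperCat.addCommGroup SuperCat.module SuperCat.superModule

/-- An even `k`-linear functor. -/
structure SuperFunctor {k : Type u} [CommRing k] (C : SuperCat.{u, v, w} k)
    (D : SuperCat.{u, x, y} k) where
  obj : C.Obj → D.Obj
  map : ∀ {X Y}, C.Hom X Y →ₗ[k] D.Hom (obj X) (obj Y)
  map_mem : ∀ {X Y} (i : ZMod 2) (f : C.Hom X Y), f ∈ homog k i → map f ∈ homog k i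
  map_id : ∀ X, map (C.id X) = D.id (obj X)
  map_comp : ∀ {X Y Z} (g : C.Hom Y Z) (f : C.Hom X Y), map (C.comp g f) = D.comp (map g) (map f)

/-- The full subcategory on the objects satisfying `p`. -/
abbrev fullSub {k : Type u} [CommRing k] (C : SuperCat.{u, v, w} k) (p : C.Obj → Prop) :
    SuperCat.{u, v, w} k where
  Obj := {X : C.Obj // p X}
  Hom X Y := C.Hom X.1 Y.1
  id X := C.id X.1
  comp := C.comp
  id_mem X := C.id_mem X.1
  comp_mem := C.comp_mem
  id_comp := C.id_comp
  comp_id := C.comp_id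
  assoc := C.assoc

section functors
variable {k : Type u} [CommRing k] {C : SuperCat.{u, v, w} k} {D : SuperCat.{u, x, y} k}

/-- `η` is a natural transformation of degree `e`: a family of morphisms of degree `e` with
`G(φ) ∘ η_X = (-1)^{|φ| e} η_Y ∘ F(φ)` for homogeneous `φ`. -/
def IsNatural (F G : SuperFunctor C D) (e : ZMod 2)
    (η : ∀ X, D.Hom (F.obj X) (G.obj X)) : Prop :=
  (∀ X, η X ∈ homog k e) ∧
  ∀ (j : ZMod 2) (X Y : C.Obj) (φ : C.Hom X Y), φ ∈ homog k j →
    D.comp (G.map φ) (η X) = sgn k (j * e) • D.comp (η Y) (F.map φ)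

/-- The module of natural transformations `F → G`: families of morphisms whose even and odd
components are natural transformations of degree `0` and `1`. -/
def natTrans (F G : SuperFunctor C D) : Submodule k (∀ X, D.Hom (F.obj X) (G.obj X)) where
  carrier := {η | ∀ e, IsNatural F G e fun X => proj k e (η X)}
  add_mem' := fun {a b} ha hb e => ⟨fun X => proj_mem _ _, fun j X Y φ hφ => by
    simp only [Pi.add_apply, map_add, LinearMap.add_apply, smul_add]
    rw [(ha e).2 j X Y φ hφ, (hb e).2 j X Y φ hφ]⟩
  zero_mem' := fun e => ⟨fun X => proj_mem _ _, fun j X Y φ hφ => by simp⟩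
  smul_mem' := fun c a ha e => ⟨fun X => proj_mem _ _, fun j X Y φ hφ => by
    simp only [Pi.smul_apply, map_smul, LinearMap.smul_apply]
    rw [(ha e).2 j X Y φ hφ, smul_comm]⟩

theorem mem_natTrans {F G : SuperFunctor C D} {e : ZMod 2}
    {η : ∀ X, D.Hom (F.obj X) (G.obj X)} (h : IsNatural F G e η) : η ∈ natTrans F G := by
  intro e'
  by_cases he : e' = e
  · subst he
    have : (fun X => proj k e' (η X)) = η := funext fun X => proj_of_mem (h.1 X)
    rw [this]
    exact h
  · have : (fun X => proj k e' (η X)) = 0 :=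
      funext fun X => proj_of_mem_ne (h.1 X) (Ne.symm he)
    rw [this]
    exact ⟨fun X => Submodule.zero_mem _, fun j X Y φ hφ => by simp⟩

theorem proj_pi (e : ZMod 2) {ι : Type*} {M : ι → Type*}
    [∀ i, AddCommGroup (M i)] [∀ i, Module k (M i)] [∀ i, SuperModule k (M i)]
    (m : ∀ i, M i) : proj k e m = fun i => proj k e (m i) := by
  have h : ∀ e, (fun i => proj k e (m i)) ∈ homog k e := fun e =>
    mem_homog_pi.mpr fun i => proj_mem _ _
  conv_lhs => rw [show m = (fun i => proj k 0 (m i)) + fun i => proj k 1 (m i) from by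
    ext i
    rw [Pi.add_apply, ← sum_zmod (fun e => proj k e (m i)), sum_proj]]
  rw [map_add, proj_of_mem_ite (h 0), proj_of_mem_ite (h 1)]
  rcases zmod_two e with rfl | rfl <;> simp

instance natTransSuperModule (F G : SuperFunctor C D) : SuperModule k (natTrans F G) :=
  superModuleOfInjective (natTrans F G).subtype (natTrans F G).injective_subtype
    (fun η e => ⟨⟨fun X => proj k e (η.1 X), mem_natTrans (η.2 e)⟩, (proj_pi e _).symm⟩)

theorem mem_homog_natTrans {F G : SuperFunctor C D} {e : ZMod 2} {η : natTrans F G} :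
    η ∈ homog k e ↔ ∀ X, η.1 X ∈ homog k e := mem_homog_pi

theorem natural_of_mem {F G : SuperFunctor C D} {e : ZMod 2} {η : natTrans F G}
    (h : η ∈ homog k e) : IsNatural F G e η.1 := by
  have := η.2 e
  rwa [funext fun X => proj_of_mem (mem_homog_natTrans.mp h X)] at this

/-- Componentwise composition of natural transformations. -/
def natComp (F G H : SuperFunctor C D) : natTrans G H →ₗ[k] natTrans F G →ₗ[k] natTrans F H :=
  LinearMap.mk₂ k (fun θ η => ⟨fun X => D.comp (θ.1 X) (η.1 X), by
    refine homog_induction (k := k) (p := fun θ : natTrans G H =>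
      (fun X => D.comp (θ.1 X) (η.1 X)) ∈ natTrans F H) θ ?_ ?_
    · intro a b ha hb
      convert Submodule.add_mem _ ha hb using 1
      ext X
      exact LinearMap.map_add₂ _ _ _ _
    · intro i θ hθ
      refine homog_induction (k := k) (p := fun η : natTrans F G =>
        (fun X => D.comp (θ.1 X) (η.1 X)) ∈ natTrans F H) η ?_ ?_
      · intro a b ha hb
        convert Submodule.add_mem _ ha hb using 1
        ext X
        exact map_add _ _ _
      · intro j η hη
        have h1 := natural_of_mem hθ
        have h2 := natural_of_mem hη
        refine mem_natTrans (e := i + j) ⟨fun X => D.comp_mem _ _ _ (h1.1 X) _ (h2.1 X), ?_⟩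
        intro l X Y φ hφ
        rw [← D.assoc, h1.2 l X Y φ hφ, LinearMap.map_smul₂, D.assoc, h2.2 l X Y φ hφ,
          map_smul, smul_smul, ← sgn_add, ← mul_add, D.assoc]⟩)
    (fun a b c => Subtype.ext <| funext fun X => LinearMap.map_add₂ _ _ _ _)
    (fun r a b => Subtype.ext <| funext fun X => LinearMap.map_smul₂ _ _ _ _)
    (fun a b c => Subtype.ext <| funext fun X => map_add _ _ _)
    (fun r a b => Subtype.ext <| funext fun X => map_smul _ _ _)

/-- The category of even `k`-linear functors `C → D`, whose morphisms are all natural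
transformations (even, odd, and sums of these). -/
abbrev funCat (C : SuperCat.{u, v, w} k) (D : SuperCat.{u, x, y} k) : SuperCat k where
  Obj := SuperFunctor C D
  Hom F G := natTrans F G
  id F := ⟨fun X => D.id (F.obj X), mem_natTrans (e := 0) ⟨fun X => D.id_mem _,
    fun j X Y φ hφ => by rw [D.comp_id, D.id_comp, mul_zero, sgn_zero, one_smul]⟩⟩
  comp := natComp _ _ _
  id_mem F := mem_homog_natTrans.mpr fun X => D.id_mem _
  comp_mem := fun i j _ ha _ hb => mem_homog_natTrans.mpr fun X =>
    D.comp_mem _ _ _ (mem_homog_natTrans.mp ha X) _ (mem_homog_natTrans.mp hb X)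
  id_comp f := Subtype.ext <| funext fun X => D.id_comp _
  comp_id f := Subtype.ext <| funext fun X => D.comp_id _
  assoc h g f := Subtype.ext <| funext fun X => D.assoc _ _ _

end functors

/-! ### Endomorphism superalgebras -/

/-- The endomorphism superalgebra of an object. -/
def SuperCat.End {k : Type u} [CommRing k] (C : SuperCat.{u, v, w} k) (X : C.Obj) : Type v :=
  C.Hom X X

section endo
variable {k : Type u} [CommRing k] (C : SuperCat.{u, v, w} k) (X : C.Obj)

instance endAddCommGroup : AddCommGroup (C.End X) := inferInstanceAs (AddCommGroup (C.Hom X X))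
instance endModule : Module k (C.End X) := inferInstanceAs (Module k (C.Hom X X))

instance endRing : Ring (C.End X) where
  __ := endAddCommGroup C X
  mul := fun f g => C.comp (X := X) (Y := X) (Z := X) f g
  one := C.id X
  mul_assoc := C.assoc (W := X) (X := X) (Y := X) (Z := X)
  one_mul := C.id_comp (X := X) (Y := X)
  mul_one := C.comp_id (X := X) (Y := X)
  left_distrib := fun a b c => map_add (C.comp (X := X) (Y := X) (Z := X) a) b c
  right_distrib := fun a b c => LinearMap.map_add₂ (C.comp (X := X) (Y := X) (Z := X)) a b c
  zero_mul := fun a => LinearMap.map_zero₂ (C.comp (X := X) (Y := X) (Z := X)) a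
  mul_zero := fun a => map_zero (C.comp (X := X) (Y := X) (Z := X) a)

instance endAlgebra : Algebra k (C.End X) :=
  Algebra.ofModule
    (fun r a b => LinearMap.map_smul₂ (C.comp (X := X) (Y := X) (Z := X)) r a b)
    (fun r a b => map_smul (C.comp (X := X) (Y := X) (Z := X) a) r b)

instance endSuperAlgebra : SuperAlgebra k (C.End X) where
  homog := SuperModule.homog (k := k) (M := C.Hom X X)
  isCompl := SuperModule.isCompl (k := k) (M := C.Hom X X)
  one_mem := C.id_mem X
  mul_mem := fun {i j} {a b} ha hb => C.comp_mem (X := X) (Y := X) (Z := X) i j a ha b hb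

end endo

/-! ### The category of supermodules and representations -/

/-- A bundled `k`-supermodule. -/
structure SMod (k : Type u) [CommRing k] where
  carrier : Type v
  [addCommGroup : AddCommGroup carrier]
  [module : Module k carrier]
  [superModule : SuperModule k carrier]

attribute [instance] SMod.addCommGroup SMod.module SMod.superModule

/-- The category of `k`-supermodules and all `k`-linear maps. -/
abbrev sModCat (k : Type u) [CommRing k] : SuperCat k where
  Obj := SMod.{u, v} k
  Hom M N := M.carrier →ₗ[k] N.carrier
  id M := LinearMap.id
  comp {M N P} := LinearMap.llcomp k M.carrier N.carrier P.carrier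
  id_mem M := fun j m hm => by rwa [add_zero]
  comp_mem := fun i j g hg f hf l m hm => by
    rw [add_comm i j, ← add_assoc]
    exact hg _ _ (hf _ _ hm)
  id_comp f := rfl
  comp_id f := rfl
  assoc h g f := rfl

/-- The category of all even `k`-linear functors from `C` to `k`-supermodules. -/
abbrev bigRep {k : Type u} [CommRing k] (C : SuperCat.{u, v, w} k) : SuperCat k :=
  funCat C (sModCat.{u, v} k)

/-- The category of representations of `C`: the full subcategory of the functors whose values are
finitely generated projective `k`-supermodules. (A `k`-supermodule is projective in the category of
`k`-supermodules and even maps if and only if the underlying `k`-module is projective.) -/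
def rep {k : Type u} [CommRing k] (C : SuperCat.{u, v, w} k) : SuperCat k :=
  fullSub (bigRep C) fun F : SuperFunctor C (sModCat.{u, v} k) =>
    ∀ X, Module.Finite k (F.obj X).carrier ∧ Module.Projective k (F.obj X).carrier

/-! ### Left supermodules -/

/-- A bundled left `R`-supermodule. -/
structure LSMod (k : Type u) (R : Type v) [CommRing k] [Ring R] [Algebra k R]
    [SuperAlgebra k R] where
  carrier : Type w
  [addCommGroup : AddCommGroup carrier]
  [module : Module k carrier]
  [rModule : Module R carrier]
  [isScalarTower : IsScalarTower k R carrier]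
  [superModule : SuperModule k carrier]
  [gradedAction : GradedAction k R carrier]

attribute [instance] LSMod.addCommGroup LSMod.module LSMod.rModule LSMod.isScalarTower
  LSMod.superModule LSMod.gradedAction

section lsmod
variable {k : Type u} {R : Type v} [CommRing k] [Ring R] [Algebra k R] [SuperAlgebra k R]

/-- A `k`-linear map `f` of degree `e` is a homomorphism of left `R`-supermodules if
`f(r m) = (-1)^{e |r|} r f(m)` for homogeneous `r`. -/
def IsSuperLinear (M N : LSMod.{u, v, w} k R) (e : ZMod 2) (f : M.carrier →ₗ[k] N.carrier) :
    Prop :=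
  f ∈ homog k e ∧ ∀ (j : ZMod 2), ∀ r ∈ homog k (M := R) j, ∀ m,
    f (r • m) = sgn k (j * e) • r • f m

/-- The supermodule of homomorphisms of left `R`-supermodules: linear maps whose even and odd
components are homomorphisms of degree `0` and `1`. -/
def superLinearMaps (M N : LSMod.{u, v, w} k R) : Submodule k (M.carrier →ₗ[k] N.carrier) where
  carrier := {f | ∀ e, IsSuperLinear M N e (proj k e f)}
  add_mem' := fun {a b} ha hb e => ⟨proj_mem _ _, fun j r hr m => by
    simp only [map_add, LinearMap.add_apply, (ha e).2 j r hr m, (hb e).2 j r hr m, smul_add]⟩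
  zero_mem' := fun e => ⟨proj_mem _ _, fun j r hr m => by simp⟩
  smul_mem' := fun c a ha e => ⟨proj_mem _ _, fun j r hr m => by
    simp only [map_smul, LinearMap.smul_apply, (ha e).2 j r hr m]
    rw [smul_algebra_smul_comm c r, smul_comm c]⟩

theorem mem_superLinearMaps {M N : LSMod.{u, v, w} k R} {e : ZMod 2}
    {f : M.carrier →ₗ[k] N.carrier} (h : IsSuperLinear M N e f) : f ∈ superLinearMaps M N := by
  intro e'
  rw [proj_of_mem_ite h.1]
  split_ifs with he
  · subst he; exact h
  · exact ⟨Submodule.zero_mem _, fun j r hr m => by simp⟩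

instance superLinearSuperModule (M N : LSMod.{u, v, w} k R) :
    SuperModule k (superLinearMaps M N) :=
  superModuleOfInjective (superLinearMaps M N).subtype (superLinearMaps M N).injective_subtype
    (fun f e => ⟨⟨proj k e f.1, mem_superLinearMaps (f.2 e)⟩, rfl⟩)

theorem isSuperLinear_of_mem {M N : LSMod.{u, v, w} k R} {e : ZMod 2} {f : superLinearMaps M N}
    (h : f ∈ homog k e) : IsSuperLinear M N e f.1 := by
  have := f.2 e
  rwa [proj_of_mem (show f.1 ∈ homog k e from h)] at this

theorem comp_mem_superLinearMaps {M N P : LSMod.{u, v, w} k R} {g : N.carrier →ₗ[k] P.carrier}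
    {f : M.carrier →ₗ[k] N.carrier} (hg : g ∈ superLinearMaps N P)
    (hf : f ∈ superLinearMaps M N) : g ∘ₗ f ∈ superLinearMaps M P := by
  have key : ∀ i j, (proj k i g) ∘ₗ (proj k j f) ∈ superLinearMaps M P := fun i j => by
    have h1 := hg i
    have h2 := hf j
    refine mem_superLinearMaps (e := i + j) ⟨?_, ?_⟩
    · intro l m hm
      rw [add_comm i j, ← add_assoc]
      exact h1.1 _ _ (h2.1 _ _ hm)
    · intro l r hr m
      rw [LinearMap.comp_apply, h2.2 l r hr, map_smul, h1.2 l r hr, smul_smul, ← sgn_add,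
        ← mul_add, add_comm j i]
      rfl
  rw [← sum_proj (k := k) g, ← sum_proj (k := k) f, sum_zmod, sum_zmod, LinearMap.add_comp,
    LinearMap.comp_add, LinearMap.comp_add]
  exact Submodule.add_mem _ (Submodule.add_mem _ (key _ _) (key _ _))
    (Submodule.add_mem _ (key _ _) (key _ _))

/-- Composition of homomorphisms of left supermodules. -/
def superLinearComp (M N P : LSMod.{u, v, w} k R) :
    superLinearMaps N P →ₗ[k] superLinearMaps M N →ₗ[k] superLinearMaps M P :=
  LinearMap.mk₂ k (fun g f => ⟨g.1 ∘ₗ f.1, comp_mem_superLinearMaps g.2 f.2⟩)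
    (fun a b c => Subtype.ext <| LinearMap.add_comp _ _ _)
    (fun r a b => Subtype.ext <| LinearMap.smul_comp _ _ _)
    (fun a b c => Subtype.ext <| LinearMap.comp_add _ _ _)
    (fun r a b => Subtype.ext <| LinearMap.comp_smul _ _ _)

end lsmod

/-- The category of left `R`-supermodules and all their homomorphisms. -/
abbrev lsModCat (k : Type u) (R : Type v) [CommRing k] [Ring R] [Algebra k R] [SuperAlgebra k R] :
    SuperCat k where
  Obj := LSMod.{u, v, w} k R
  Hom M N := superLinearMaps M N
  id M := ⟨LinearMap.id, mem_superLinearMaps (e := 0)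
    ⟨fun j m hm => by rwa [add_zero], fun j r hr m => by simp [sgn_zero]⟩⟩
  comp {M N P} := superLinearComp M N P
  id_mem M := fun j m hm => by rw [add_zero]; exact hm
  comp_mem := fun i j g hg f hf l m hm => by
    rw [add_comm i j, ← add_assoc]
    exact hg _ _ (hf _ _ hm)
  id_comp f := rfl
  comp_id f := rfl
  assoc h g f := rfl

/-! ### Evaluation and hom functors -/

section homs
variable {k : Type u} [CommRing k] {C : SuperCat.{u, v, w} k}

/-- The value `F(X)` of a functor, as a left supermodule over `End(X)` via `f • v = F(f)(v)`. -/
def evalMod (F : SuperFunctor C (sModCat.{u, y} k)) (X : C.Obj) : LSMod.{u, v, y} k (C.End X) :=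
  letI act : Module (C.End X) (F.obj X).carrier :=
    { smul := fun f m => (F.map (X := X) (Y := X) f : (F.obj X).carrier →ₗ[k] (F.obj X).carrier) m
      one_smul := fun m => LinearMap.congr_fun (F.map_id X) m
      mul_smul := fun f g m => LinearMap.congr_fun (F.map_comp (X := X) (Y := X) (Z := X) f g) m
      smul_zero := fun f => map_zero (F.map (X := X) (Y := X) f :
        (F.obj X).carrier →ₗ[k] (F.obj X).carrier)
      smul_add := fun f => map_add (F.map (X := X) (Y := X) f :
        (F.obj X).carrier →ₗ[k] (F.obj X).carrier)
      add_smul := fun f g m => LinearMap.congr_fun (map_add (F.map (X := X) (Y := X)) f g) m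
      zero_smul := fun m => LinearMap.congr_fun (map_zero (F.map (X := X) (Y := X))) m }
  { carrier := (F.obj X).carrier
    isScalarTower := ⟨fun c f m =>
      LinearMap.congr_fun (map_smul (F.map (X := X) (Y := X)) c f) m⟩
    gradedAction := ⟨fun {i j} {f m} hf hm => by
      rw [add_comm]
      exact F.map_mem (X := X) (Y := X) i f hf j m hm⟩ }

/-- `Hom(X, Y)` is a left module over the super-opposite of `End(X)`, by precomposition and the
rule of signs: `f • α = (-1)^{|f| |α|} α ∘ f`. -/
instance precompModule (X Y : C.Obj) : Module (SuperOpposite k (C.End X)) (C.Hom X Y) where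
  smul f α := superTwist (C.comp (X := X) (Y := X) (Z := Y)).flip f.unop α
  one_smul α := superTwist_one (C.id_mem X) C.comp_id α
  mul_smul f g α := superTwist_assoc (M := C.Hom X X) (N := C.Hom X Y) C.comp_mem C.comp_mem
    (fun n a b => C.assoc n a b) f.unop g.unop α
  smul_zero f := map_zero (superTwist (C.comp (X := X) (Y := X) (Z := Y)).flip f.unop)
  smul_add f := map_add (superTwist (C.comp (X := X) (Y := X) (Z := Y)).flip f.unop)
  add_smul f g α := LinearMap.map_add₂ (superTwist (C.comp (X := X) (Y := X) (Z := Y)).flip) _ _ _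
  zero_smul α := LinearMap.map_zero₂ (superTwist (C.comp (X := X) (Y := X) (Z := Y)).flip) _

theorem precomp_smul_def {X Y : C.Obj} (f : SuperOpposite k (C.End X)) (α : C.Hom X Y) :
    f • α = superTwist (C.comp (X := X) (Y := X) (Z := Y)).flip f.unop α := rfl

theorem superTwist_comp {X Y Z : C.Obj} {e j : ZMod 2} {f : C.Hom X X} (hf : f ∈ homog k j)
    {β : C.Hom Y Z} (hβ : β ∈ homog k e) (α : C.Hom X Y) :
    C.comp β (superTwist (C.comp (X := X) (Y := X) (Z := Y)).flip f α) =
      sgn k (j * e) • superTwist (C.comp (X := X) (Y := X) (Z := Z)).flip f (C.comp β α) := by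
  refine LinearMap.congr_fun
    (f := (C.comp β) ∘ₗ (superTwist (C.comp (X := X) (Y := X) (Z := Y)).flip f))
    (g := sgn k (j * e) • ((superTwist (C.comp (X := X) (Y := X) (Z := Z)).flip f) ∘ₗ (C.comp β)))
    (ext_homog fun i x hx => ?_) α
  rw [LinearMap.smul_apply, LinearMap.comp_apply, LinearMap.comp_apply, superTwist_apply _ hf hx,
    superTwist_apply _ hf (C.comp_mem _ _ _ hβ _ hx), map_smul, smul_smul, ← sgn_add]
  have : j * e + j * (e + i) = j * i := by
    have h2 : ∀ a : ZMod 2, a + a = 0 := by decide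
    rw [mul_add, ← add_assoc, h2, zero_add]
  rw [this, LinearMap.flip_apply, LinearMap.flip_apply, C.assoc]

/-- For an even homomorphism `Φ` from a superalgebra `R` to the super-opposite of `End(X)`, the
left `R`-supermodule `Hom(X, Y)`, with `r • α = Φ(r) • α = (-1)^{|r| |α|} α ∘ Φ(r)`. -/
abbrev homObj {R : Type x} [Ring R] [Algebra k R] [SuperAlgebra k R] (X : C.Obj)
    (Φ : R →ₐ[k] SuperOpposite k (C.End X)) (hΦ : ∀ i, ∀ r ∈ homog k (M := R) i, Φ r ∈ homog k i)
    (Y : C.Obj) : LSMod.{u, x, v} k R :=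
  letI act : Module R (C.Hom X Y) := Module.compHom (C.Hom X Y) Φ.toRingHom
  { carrier := C.Hom X Y
    isScalarTower := ⟨fun c r α => by
      change Φ (c • r) • α = c • (Φ r • α)
      rw [map_smul]
      exact LinearMap.map_smul₂ (superTwist (C.comp (X := X) (Y := X) (Z := Y)).flip) _ _ _⟩
    gradedAction := ⟨fun {i j} {r α} hr hα => by
      exact superTwist_mem C.comp_mem i j (Φ r).unop (hΦ i r hr) α hα⟩ }

theorem postcomp_mem {R : Type x} [Ring R] [Algebra k R] [SuperAlgebra k R] (X : C.Obj)
    (Φ : R →ₐ[k] SuperOpposite k (C.End X)) (hΦ : ∀ i, ∀ r ∈ homog k (M := R) i, Φ r ∈ homog k i)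
    {Y Z : C.Obj} (β : C.Hom Y Z) :
    (C.comp β : C.Hom X Y →ₗ[k] C.Hom X Z) ∈
      superLinearMaps (homObj X Φ hΦ Y) (homObj X Φ hΦ Z) := by
  refine homog_induction (k := k) (p := fun β : C.Hom Y Z =>
    (C.comp β : C.Hom X Y →ₗ[k] C.Hom X Z) ∈
      superLinearMaps (homObj X Φ hΦ Y) (homObj X Φ hΦ Z)) β ?_ ?_
  · intro a b ha hb
    rw [map_add]
    exact Submodule.add_mem _ ha hb
  · intro e β hβ
    refine mem_superLinearMaps (e := e) ⟨fun j α hα => ?_, fun j r hr α => ?_⟩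
    · rw [add_comm]
      exact C.comp_mem _ _ _ hβ _ hα
    · exact superTwist_comp (hΦ j r hr) hβ α

/-- For an even homomorphism `Φ` from a superalgebra `R` to the super-opposite of `End(X)`, the
functor `Hom(X, -)` from `C` to left `R`-supermodules; morphisms act by postcomposition. -/
def homFunctor {R : Type x} [Ring R] [Algebra k R] [SuperAlgebra k R] (X : C.Obj)
    (Φ : R →ₐ[k] SuperOpposite k (C.End X)) (hΦ : ∀ i, ∀ r ∈ homog k (M := R) i, Φ r ∈ homog k i) :
    SuperFunctor C (lsModCat.{u, x, v} k R) where
  obj Y := homObj X Φ hΦ Y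
  map {Y Z} := LinearMap.codRestrict (superLinearMaps (homObj X Φ hΦ Y) (homObj X Φ hΦ Z))
    (C.comp (X := X) (Y := Y) (Z := Z)) (postcomp_mem X Φ hΦ)
  map_mem i β hβ := fun j α hα => by
    rw [add_comm]
    exact C.comp_mem _ _ _ hβ _ hα
  map_id Y := Subtype.ext <| LinearMap.ext fun α => C.id_comp α
  map_comp g f := Subtype.ext <| LinearMap.ext fun α => C.assoc g f α

/-- The representable functor `h^X = Hom(X, -)`. -/
def homRep (X : C.Obj) : SuperFunctor C (sModCat.{u, v} k) where
  obj Y := { carrier := C.Hom X Y }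
  map {Y Z} := C.comp (X := X) (Y := Y) (Z := Z)
  map_mem i f hf := fun j α hα => by
    rw [add_comm]
    exact C.comp_mem _ _ _ hf _ hα
  map_id Y := LinearMap.ext fun α => C.id_comp α
  map_comp g f := LinearMap.ext fun α => C.assoc g f α

/-- For `f : X → X`, the natural transformation `h^X → h^X` given by
`β ↦ (-1)^{|f| |β|} β ∘ f`. -/
def precompNat (X : C.Obj) :
    C.Hom X X →ₗ[k] natTrans (D := sModCat.{u, v} k) (homRep X) (homRep X) :=
  LinearMap.codRestrict _ (LinearMap.pi fun Y =>
      (superTwist (C.comp (X := X) (Y := X) (Z := Y)).flip :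
        C.Hom X X →ₗ[k] C.Hom X Y →ₗ[k] C.Hom X Y)) (fun f => by
    refine homog_induction (k := k) (p := fun f : C.Hom X X =>
      (LinearMap.pi fun Y => (superTwist (C.comp (X := X) (Y := X) (Z := Y)).flip :
        C.Hom X X →ₗ[k] C.Hom X Y →ₗ[k] C.Hom X Y)) f ∈
      natTrans (D := sModCat.{u, v} k) (homRep X) (homRep X)) f ?_ ?_
    · intro a b ha hb
      rw [map_add]
      exact Submodule.add_mem _ ha hb
    · intro e f hf
      refine mem_natTrans (e := e) ⟨fun Y j α hα => ?_, fun j Y Z φ hφ => ?_⟩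
      · rw [add_comm]
        exact superTwist_mem C.comp_mem _ _ _ hf _ hα
      · refine LinearMap.ext fun α => ?_
        rw [mul_comm]
        exact superTwist_comp hf hφ α)

theorem precompNat_mem (X : C.Obj) (i : ZMod 2) (f : C.Hom X X) (hf : f ∈ homog k i) :
    precompNat X f ∈ homog k i := by
  refine mem_homog_natTrans.mpr fun Y j α hα => ?_
  rw [add_comm]
  exact superTwist_mem C.comp_mem _ _ _ hf _ hα

theorem precompNat_comp (X : C.Obj) (f g : C.Hom X X) :
    precompNat X (C.comp f g) =
      superTwist (natComp (D := sModCat.{u, v} k) (homRep X) (homRep X) (homRep X)).flip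
        (precompNat X f) (precompNat X g) := by
  refine LinearMap.congr_fun₂ (f := (C.comp (X := X) (Y := X) (Z := X)).compr₂ (precompNat X))
    (g := (superTwist (natComp (D := sModCat.{u, v} k) (homRep X) (homRep X)
      (homRep X)).flip).compl₁₂ (precompNat X) (precompNat X))
    (ext_homog₂ fun i j f hf g hg => ?_) f g
  rw [LinearMap.compr₂_apply, LinearMap.compl₁₂_apply,
    superTwist_apply _ (precompNat_mem X i f hf) (precompNat_mem X j g hg)]
  have h1 : C.comp f g = sgn k (i * j) • superTwist (C.comp (X := X) (Y := X) (Z := X)).flip g f := by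
    have h2 : j * i = i * j := mul_comm _ _
    have h3 : i * j + i * j = 0 := by
      have : ∀ a : ZMod 2, a + a = 0 := by decide
      exact this _
    rw [superTwist_apply _ hg hf, smul_smul, h2, ← sgn_add, h3, sgn_zero, one_smul]
    rfl
  rw [h1, map_smul]
  congr 1
  refine Subtype.ext <| funext fun Y => LinearMap.ext fun α => ?_
  exact superTwist_assoc (M := C.Hom X X) (N := C.Hom X Y) C.comp_mem C.comp_mem
    (fun n a b => C.assoc n a b) g f α

/-- The canonical homomorphism from `End(X)` to the super-opposite of `End(h^X)`. -/
def precompHom (X : C.Obj) :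
    C.End X →ₐ[k] SuperOpposite k ((bigRep C).End (homRep X)) :=
  AlgHom.ofLinearMap (precompNat X)
    (Subtype.ext <| funext fun Y => LinearMap.ext fun α =>
      superTwist_one (C.id_mem X) C.comp_id α)
    (precompNat_comp X)

theorem precompHom_mem (X : C.Obj) (i : ZMod 2) (f : C.End X) (hf : f ∈ homog k i) :
    precompHom X f ∈ homog k i :=
  precompNat_mem X i f hf

end homs

/-! ### Schur categories -/

section gamma
variable {k : Type u} [CommRing k]

theorem tprod_const_mem {M : Type v} [AddCommGroup M] [Module k M] [SuperModule k M] {d : ℕ}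
    {m : M} (hm : m ∈ homog k 0) : PiTensorProduct.tprod k (fun _ => m) ∈ divPow k M d := by
  intro σ
  rw [permAct_tprod σ (ε := fun _ => 0) (fun _ => hm)]
  have : permSign σ (fun _ : Fin d => (0 : ZMod 2)) = 0 := by simp [permSign]
  rw [this, sgn_zero, one_smul]

theorem tensorMap₂_id_left {M N : Type*} [AddCommGroup M] [Module k M] [SuperModule k M]
    [AddCommGroup N] [Module k N] [SuperModule k N] {d : ℕ} {μ : M →ₗ[k] N →ₗ[k] N} {m : M}
    (hm : m ∈ homog k 0) (h : ∀ n, μ m n = n) (t : TPow k N d) :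
    tensorMap₂ d μ (PiTensorProduct.tprod k fun _ => m) t = t := by
  refine LinearMap.congr_fun (f := tensorMap₂ d μ (PiTensorProduct.tprod k fun _ => m))
    (g := LinearMap.id) (ext_tensor fun ε n hn => ?_) t
  rw [tensorMap₂_tprod μ (ε := fun _ => 0) (fun _ => hm) hn]
  simp [shuffleSign, sgn_zero, h]

theorem tensorMap₂_id_right {M N : Type*} [AddCommGroup M] [Module k M] [SuperModule k M]
    [AddCommGroup N] [Module k N] [SuperModule k N] {d : ℕ} {μ : N →ₗ[k] M →ₗ[k] N} {m : M}
    (hm : m ∈ homog k 0) (h : ∀ n, μ n m = n) (t : TPow k N d) :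
    tensorMap₂ d μ t (PiTensorProduct.tprod k fun _ => m) = t := by
  refine LinearMap.congr_fun (f := (tensorMap₂ d μ).flip (PiTensorProduct.tprod k fun _ => m))
    (g := LinearMap.id) (ext_tensor fun ε n hn => ?_) t
  rw [LinearMap.flip_apply, tensorMap₂_tprod μ (δ := fun _ => 0) hn (fun _ => hm)]
  simp [shuffleSign, sgn_zero, h]

/-- The category `Γ^d C`: its objects are those of `C`, its morphisms are the divided powers
`Γ^d Hom(X, Y)`, and composition is induced by the composition of `C` on tensor powers, with the
rule of signs. -/
abbrev gammaCat (d : ℕ) (C : SuperCat.{u, v, w} k) : SuperCat k where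
  Obj := C.Obj
  Hom X Y := divPow k (C.Hom X Y) d
  id X := ⟨PiTensorProduct.tprod k fun _ => C.id X, tprod_const_mem (C.id_mem X)⟩
  comp {X Y Z} := LinearMap.mk₂ k
    (fun g f => ⟨tensorMap₂ d C.comp g.1 f.1, fun σ => by
      rw [permAct_tensorMap₂ σ C.comp_mem, g.2 σ, f.2 σ]⟩)
    (fun a b c => Subtype.ext <| LinearMap.map_add₂ _ _ _ _)
    (fun r a b => Subtype.ext <| LinearMap.map_smul₂ _ _ _ _)
    (fun a b c => Subtype.ext <| map_add _ _ _)
    (fun r a b => Subtype.ext <| map_smul _ _ _)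
  id_mem X := by
    have h := tprod_mem (k := k) (d := d) (ε := fun _ => 0) (m := fun _ => C.id X)
      (fun _ => C.id_mem X)
    rw [Finset.sum_const_zero] at h
    exact h
  comp_mem := fun i j g hg f hf => tensorMap₂_mem C.comp_mem i j g.1 hg f.1 hf
  id_comp {X Y} f := Subtype.ext <| tensorMap₂_id_left (C.id_mem Y) C.id_comp f.1
  comp_id {X Y} f := Subtype.ext <| tensorMap₂_id_right (C.id_mem X) C.comp_id f.1
  assoc h g f := Subtype.ext <| tensorMap₂_assoc C.comp_mem C.comp_mem C.assoc h.1 g.1 f.1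

end gamma

/-! ### Evenly generated projective supermodules -/

section EA
variable (k : Type u) [CommRing k] (A : Type u) [Ring A] [Algebra k A] [SuperAlgebra k A]

/-- An evenly generated projective right `A`-supermodule: there is an even surjection `A^n → M`,
and `M` is projective for even homomorphisms. -/
structure EvGenProj where
  carrier : Type u
  [addCommGroup : AddCommGroup carrier]
  [module : Module k carrier]
  [aModule : Module Aᵐᵒᵖ carrier]
  [isScalarTower : IsScalarTower k Aᵐᵒᵖ carrier]
  [superModule : SuperModule k carrier]
  [gradedAction : GradedAction k Aᵐᵒᵖ carrier]
  evenlyGenerated : ∃ (n : ℕ) (f : (Fin n → A) →ₗ[Aᵐᵒᵖ] carrier),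
    (∀ i, ∀ m ∈ homog k i, f m ∈ homog k i) ∧ Function.Surjective f
  projective : IsSuperProjective.{u, u, u, u} k Aᵐᵒᵖ carrier

attribute [instance] EvGenProj.addCommGroup EvGenProj.module EvGenProj.aModule
  EvGenProj.isScalarTower EvGenProj.superModule EvGenProj.gradedAction

/-- The category of evenly generated projective right `A`-supermodules and all homomorphisms. -/
abbrev evGenCat : SuperCat k where
  Obj := EvGenProj k A
  Hom X Y := X.carrier →ₗ[Aᵐᵒᵖ] Y.carrier
  id X := LinearMap.id
  comp {X Y Z} := LinearMap.mk₂ k (fun g f => g ∘ₗ f)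
    (fun a b c => LinearMap.add_comp _ _ _)
    (fun r a b => LinearMap.smul_comp _ _ _)
    (fun a b c => LinearMap.comp_add _ _ _)
    (fun r a b => by
      ext x
      change a (r • b x) = r • a (b x)
      exact (a.restrictScalars k).map_smul r (b x))
  id_mem X := fun j m hm => by rw [add_zero]; exact hm
  comp_mem := fun i j g hg f hf l m hm => by
    rw [add_comm i j, ← add_assoc]
    exact hg _ _ (hf _ _ hm)
  id_comp f := rfl
  comp_id f := rfl
  assoc h g f := rfl

instance freeGradedAction (n : ℕ) : GradedAction k Aᵐᵒᵖ (Fin n → A) where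
  smul_mem {i j a m} ha hm := mem_homog_pi.mpr fun l => by
    rw [add_comm]
    exact mul_mem_homog (mem_homog_pi.mp hm l) ha

/-- The free supermodule `A^n`, as an evenly generated projective right `A`-supermodule. -/
def freeObj (n : ℕ) : EvGenProj k A where
  carrier := Fin n → A
  evenlyGenerated := ⟨n, LinearMap.id, fun _ _ hm => hm, Function.surjective_id⟩
  projective N P := by
    intro _ _ _ _ _ _ _ _ _ _ _ _ g f hg hf hs
    have h1 : ∀ i : Fin n, ∃ x : N, x ∈ homog k 0 ∧ g x = f (Pi.single i 1) := fun i => by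
      obtain ⟨x, hx⟩ := hs (f (Pi.single i 1))
      refine ⟨proj k 0 x, proj_mem _ _, ?_⟩
      have h2 : f (Pi.single i 1) ∈ homog k 0 := hf 0 _ <| mem_homog_pi.mpr fun j => by
        by_cases h : j = i
        · subst h
          rw [Pi.single_eq_same]
          exact SuperAlgebra.one_mem
        · rw [Pi.single_eq_of_ne h]
          exact Submodule.zero_mem _
      rw [← hx, ← sum_proj (k := k) x, sum_zmod, map_add] at h2
      have h3 := proj_of_mem h2
      rw [map_add, proj_of_mem (hg 0 _ (proj_mem _ _)),
        proj_of_mem_ne (hg 1 _ (proj_mem _ _)) (by decide), add_zero] at h3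
      rw [h3, ← map_add, ← sum_zmod (fun i => proj k i x), sum_proj, hx]
    choose b hb hgb using h1
    refine ⟨{ toFun := fun m => ∑ i, MulOpposite.op (m i) • b i
              map_add' := fun m m' => by simp [add_smul, Finset.sum_add_distrib]
              map_smul' := fun a m => by
                simp [Finset.smul_sum, smul_smul] }, ?_, ?_⟩
    · intro i m hm
      change ∑ l, MulOpposite.op (m l) • b l ∈ homog k i
      refine Submodule.sum_mem _ fun l _ => ?_
      have := GradedAction.smul_mem (k := k) (R := Aᵐᵒᵖ) (i := i) (j := 0)
        (a := MulOpposite.op (m l)) (mem_homog_op.mpr (mem_homog_pi.mp hm l)) (hb l)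
      rwa [add_zero] at this
    · refine LinearMap.ext fun m => ?_
      change g (∑ i, MulOpposite.op (m i) • b i) = f m
      have hm : m = ∑ i, MulOpposite.op (m i) • (Pi.single i 1 : Fin n → A) := by
        ext j
        simp [Finset.sum_apply, Pi.single_apply]
      conv_rhs => rw [hm, map_sum]
      rw [map_sum]
      exact Finset.sum_congr rfl fun i _ => by rw [map_smul, map_smul, hgb]

end EA

section tensorFunctor
variable {k : Type u} [CommRing k] {A : Type u} [Ring A] [Algebra k A] [SuperAlgebra k A]

theorem EvGenProj.exists_section (X : EvGenProj k A) : ∃ (n : ℕ)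
    (p : (Fin n → A) →ₗ[k] X.carrier) (s : X.carrier →ₗ[k] (Fin n → A)), p ∘ₗ s = LinearMap.id := by
  obtain ⟨n, f, hf, hs⟩ := X.evenlyGenerated
  obtain ⟨h, _, hh⟩ := X.projective (Fin n → A) X.carrier f LinearMap.id hf (fun _ _ hm => hm) hs
  exact ⟨n, f.restrictScalars k, h.restrictScalars k, by
    ext x
    exact LinearMap.congr_fun hh x⟩

theorem finite_of_section {M N : Type u} [AddCommGroup M] [Module k M] [AddCommGroup N] [Module k N]
    [Module.Finite k M] [Module.Projective k M] (p : M →ₗ[k] N) (s : N →ₗ[k] M)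
    (h : p ∘ₗ s = LinearMap.id) : Module.Finite k N ∧ Module.Projective k N :=
  ⟨Module.Finite.of_surjective p fun x => ⟨s x, LinearMap.congr_fun h x⟩,
    Module.Projective.of_split s p h⟩

theorem tensor_finite_projective {M : Type u} [AddCommGroup M] [Module k M] [Module.Finite k M]
    [Module.Projective k M] (d : ℕ) :
    Module.Finite k (TPow k M d) ∧ Module.Projective k (TPow k M d) := by
  obtain ⟨n, f, hf⟩ := Module.Finite.exists_fin' k M
  obtain ⟨s, hs⟩ := Module.projective_lifting_property f LinearMap.id hf
  have : Module.Free k (TPow k (Fin n → k) d) :=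
    Module.Free.of_basis (Basis.piTensorProduct fun _ => Pi.basisFun k (Fin n))
  refine finite_of_section (M := TPow k (Fin n → k) d) (PiTensorProduct.map fun _ => f)
    (PiTensorProduct.map fun _ => s) ?_
  rw [← PiTensorProduct.map_comp, hs, PiTensorProduct.map_id]

/-- Evaluation of homomorphisms of right supermodules, as a bilinear map. -/
def evalMap (X Y : EvGenProj k A) :
    (X.carrier →ₗ[Aᵐᵒᵖ] Y.carrier) →ₗ[k] X.carrier →ₗ[k] Y.carrier :=
  LinearMap.restrictScalarsₗ k Aᵐᵒᵖ X.carrier Y.carrier k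

theorem evalMap_even (X Y : EvGenProj k A) : IsEven₂ (evalMap X Y) := fun i j f hf m hm => by
  rw [add_comm]
  exact hf j m hm

/-- The functor `⊗^d`, from `Γ^d` of the category of evenly generated projective right
`A`-supermodules to `k`-supermodules: it maps `X` to `X^{⊗d}`, and a morphism
`∑ f_1 ⊗ ⋯ ⊗ f_d` to the sum of the maps `f_1 ⊠ ⋯ ⊠ f_d` (with the rule of signs). -/
def tensorFunctor (k : Type u) [CommRing k] (A : Type u) [Ring A] [Algebra k A] [SuperAlgebra k A]
    (d : ℕ) : SuperFunctor (gammaCat d (evGenCat k A)) (sModCat.{u, u} k) where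
  obj X := { carrier := TPow k X.carrier d }
  map {X Y} := (tensorMap₂ d (evalMap X Y)).domRestrict _
  map_mem {X Y} i f hf := fun j t ht => by
    rw [add_comm]
    exact tensorMap₂_mem (evalMap_even X Y) i j f.1 hf t ht
  map_id X := LinearMap.ext fun t =>
    tensorMap₂_id_left ((evGenCat k A).id_mem X) (fun _ => rfl) t
  map_comp {X Y Z} g f := LinearMap.ext fun t =>
    tensorMap₂_assoc (μ := (evGenCat k A).comp) (ν := evalMap X Z) (μ' := evalMap X Y)
      (ν' := evalMap Y Z) (evGenCat k A).comp_mem (evalMap_even X Y) (fun _ _ _ => rfl) g.1 f.1 t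

/-- The category of generalized polynomial functors of degree `d` over `A`. -/
abbrev polyCat (k : Type u) [CommRing k] (A : Type u) [Ring A] [Algebra k A] [SuperAlgebra k A]
    (d : ℕ) : SuperCat k := rep (gammaCat d (evGenCat k A))

/-- `⊗^d`, as a generalized polynomial functor of degree `d`. -/
def tensorObj (k : Type u) [CommRing k] (A : Type u) [Ring A] [Algebra k A] [SuperAlgebra k A]
    [Module.Finite k A] [Module.Free k A] (d : ℕ) : (polyCat k A d).Obj :=
  ⟨tensorFunctor k A d, fun X => by
    obtain ⟨n, p, s, h⟩ := X.exists_section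
    obtain ⟨_, _⟩ := finite_of_section p s h
    exact tensor_finite_projective d⟩

/-- The Schur superalgebra `S^A(n, d) = Γ^d End_A(A^n)`: the endomorphism superalgebra of `A^n` in
the category `Γ^d` of evenly generated projective right `A`-supermodules. -/
abbrev SchurAlg (k : Type u) [CommRing k] (A : Type u) [Ring A] [Algebra k A] [SuperAlgebra k A]
    (n d : ℕ) : Type u := (gammaCat d (evGenCat k A)).End (freeObj k A n)

end tensorFunctor

/-! ### Wreath product superalgebras -/

/-- The tensor power `A^{⊗d}` of a superalgebra, with the multiplication given by the rule of
signs. -/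
def TensorAlg (k : Type u) [CommRing k] (A : Type v) [Ring A] [Algebra k A] (d : ℕ) : Type _ :=
  TPow k A d

section wreath
variable {k : Type u} [CommRing k] {A : Type v} [Ring A] [Algebra k A] [SuperAlgebra k A] {d : ℕ}

instance : AddCommGroup (TensorAlg k A d) := inferInstanceAs (AddCommGroup (TPow k A d))
instance tensorAlgModule : Module k (TensorAlg k A d) := inferInstanceAs (Module k (TPow k A d))

instance tensorAlgRing : Ring (TensorAlg k A d) where
  __ := (inferInstance : AddCommGroup (TensorAlg k A d))
  mul := fun a b => tensorMap₂ (k := k) d (mulMap k A) a b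
  one := PiTensorProduct.tprod k fun _ => (1 : A)
  mul_assoc := tensorMap₂_assoc (mulMap_even (k := k) (R := A)) (mulMap_even (k := k) (R := A))
    (mul_assoc (G := A))
  one_mul := tensorMap₂_id_left (N := A) (μ := mulMap k A) (SuperAlgebra.one_mem (k := k) (R := A))
    (one_mul (M := A))
  mul_one := tensorMap₂_id_right (N := A) (μ := mulMap k A) (SuperAlgebra.one_mem (k := k) (R := A))
    (mul_one (M := A))
  left_distrib := fun a b c => map_add (tensorMap₂ (k := k) d (mulMap k A) a) b c
  right_distrib := fun a b c => LinearMap.map_add₂ (tensorMap₂ (k := k) d (mulMap k A)) a b c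
  zero_mul := fun a => LinearMap.map_zero₂ (tensorMap₂ (k := k) d (mulMap k A)) a
  mul_zero := fun a => map_zero (tensorMap₂ (k := k) d (mulMap k A) a)

instance : Algebra k (TensorAlg k A d) :=
  Algebra.ofModule (fun r a b => LinearMap.map_smul₂ (tensorMap₂ (k := k) d (mulMap k A)) r a b)
    (fun r a b => map_smul (tensorMap₂ (k := k) d (mulMap k A) a) r b)

theorem tprod_const_mem_homog {M : Type w} [AddCommGroup M] [Module k M] [SuperModule k M] {m : M}
    (hm : m ∈ homog k 0) : (PiTensorProduct.tprod k fun _ => m : TPow k M d) ∈ homog k 0 := by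
  have h := tprod_mem (k := k) (d := d) (ε := fun _ => 0) (m := fun _ => m) (fun _ => hm)
  rwa [Finset.sum_const_zero] at h

instance : SuperAlgebra k (TensorAlg k A d) where
  toSuperModule := (tensorSuperModule : SuperModule k (TPow k A d))
  one_mem := tprod_const_mem_homog (M := A) (SuperAlgebra.one_mem (k := k) (R := A))
  mul_mem := fun {i j} {a b} ha hb =>
    tensorMap₂_mem (mulMap_even (k := k) (R := A)) i j a ha b hb

/-- The left action `σ • x = x.σ⁻¹` of the symmetric group on `A^{⊗d}` by algebra automorphisms. -/
instance : MulSemiringAction (Equiv.Perm (Fin d)) (TensorAlg k A d) where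
  smul σ a := permAct (k := k) (M := A) σ⁻¹ a
  one_smul a := permAct_one (k := k) (M := A) a
  mul_smul σ τ a := by
    have h := permAct_mul (k := k) (M := A) τ⁻¹ σ⁻¹ a
    rw [← mul_inv_rev] at h
    exact h
  smul_zero σ := map_zero (permAct (k := k) (M := A) σ⁻¹)
  smul_add σ := map_add (permAct (k := k) (M := A) σ⁻¹)
  smul_one σ := tprod_const_mem (k := k) (M := A) (SuperAlgebra.one_mem (k := k) (R := A)) σ⁻¹
  smul_mul σ := permAct_tensorMap₂ σ⁻¹ (mulMap_even (k := k) (R := A))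

theorem perm_smul_def (σ : Equiv.Perm (Fin d)) (a : TensorAlg k A d) :
    σ • a = permAct (k := k) (M := A) σ⁻¹ a := rfl

end wreath

/-- The wreath product superalgebra `A ≀ 𝔖_d`: the free `A^{⊗d}`-module on the symmetric group, that
is `A^{⊗d} ⊗ k𝔖_d`, with the multiplication `(x ⊗ ρ)(y ⊗ σ) = x (y.ρ⁻¹) ⊗ ρσ`. -/
abbrev Wreath (k : Type u) [CommRing k] (A : Type v) [Ring A] [Algebra k A] [SuperAlgebra k A]
    (d : ℕ) : Type _ := SkewMonoidAlgebra (TensorAlg k A d) (Equiv.Perm (Fin d))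

section wreath
variable {k : Type u} [CommRing k] {A : Type v} [Ring A] [Algebra k A] [SuperAlgebra k A] {d : ℕ}

theorem perm_smul_smul (σ : Equiv.Perm (Fin d)) (r : k) (a : TensorAlg k A d) :
    σ • (r • a) = r • (σ • a) := map_smul (permAct (k := k) (M := A) σ⁻¹) r a

theorem wreath_coeff_mul (f g : Wreath k A d) (σ : Equiv.Perm (Fin d)) :
    (f * g).coeff σ = ∑ ρ, f.coeff ρ * (ρ • g.coeff (ρ⁻¹ * σ)) := by
  rw [SkewMonoidAlgebra.coeff_mul_left, SkewMonoidAlgebra.sum_def, Finsupp.sum_fintype]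
  intro i
  rw [zero_mul]

theorem wreath_coeff_smul (r : k) (f : Wreath k A d) (σ : Equiv.Perm (Fin d)) :
    (r • f).coeff σ = r • f.coeff σ := by
  rw [SkewMonoidAlgebra.coeff_smul]
  rfl

instance : Algebra k (Wreath k A d) :=
  Algebra.ofModule
    (fun r a b => by
      refine SkewMonoidAlgebra.ext fun σ => ?_
      rw [wreath_coeff_mul, wreath_coeff_smul, wreath_coeff_mul, Finset.smul_sum]
      refine Finset.sum_congr rfl fun ρ _ => ?_
      rw [wreath_coeff_smul, smul_mul_assoc])
    (fun r a b => by
      refine SkewMonoidAlgebra.ext fun σ => ?_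
      rw [wreath_coeff_mul, wreath_coeff_smul, wreath_coeff_mul, Finset.smul_sum]
      refine Finset.sum_congr rfl fun ρ _ => ?_
      rw [wreath_coeff_smul, perm_smul_smul, mul_smul_comm])

/-- The coefficients of an element of the wreath product, as a linear map. -/
def wreathCoeff : Wreath k A d →ₗ[k] Equiv.Perm (Fin d) → TensorAlg k A d where
  toFun w := w.coeff
  map_add' a b := by rw [SkewMonoidAlgebra.coeff_add, Finsupp.coe_add]
  map_smul' r a := funext fun σ => wreath_coeff_smul r a σ

/-- The wreath product is graded by the degree of the factor in `A^{⊗d}`. -/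
instance : SuperAlgebra k (Wreath k A d) where
  toSuperModule := superModuleOfInjective (wreathCoeff (k := k) (A := A) (d := d))
    (fun a b h => SkewMonoidAlgebra.coeff_injective (DFunLike.coe_injective h))
    (fun w e => ⟨⟨w.coeff.mapRange (proj k e) (map_zero _)⟩, (proj_pi e _).symm⟩)
  one_mem := mem_homog_pi.mpr fun σ => by
    change (1 : Wreath k A d).coeff σ ∈ homog k 0
    rw [SkewMonoidAlgebra.coeff_one, Finsupp.single_apply]
    split_ifs
    · exact SuperAlgebra.one_mem
    · exact Submodule.zero_mem _
  mul_mem := fun {i j} {a b} ha hb => mem_homog_pi.mpr fun σ => by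
    change (a * b).coeff σ ∈ homog k (i + j)
    rw [wreath_coeff_mul]
    refine Submodule.sum_mem _ fun ρ _ => mul_mem_homog (mem_homog_pi.mp ha ρ) ?_
    exact permAct_mem (k := k) (M := A) ρ⁻¹ (mem_homog_pi.mp hb (ρ⁻¹ * σ))

/-- The right action of `A ≀ 𝔖_d` on `X^{⊗d}`, for a right `A`-supermodule `X`:
`v · (x ⊗ ρ) = (v x).ρ`, where `A^{⊗d}` acts on `X^{⊗d}` by the rule of signs. -/
def wreathAct {X : Type w} [AddCommGroup X] [Module k X] [Module Aᵐᵒᵖ X] [IsScalarTower k Aᵐᵒᵖ X]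
    [SuperModule k X] [GradedAction k Aᵐᵒᵖ X] (v : TPow k X d) (w : Wreath k A d) : TPow k X d :=
  ∑ ρ : Equiv.Perm (Fin d), permAct ρ (tensorMap₂ d
    (LinearMap.mk₂ k (fun (x : X) (a : A) => MulOpposite.op a • x)
      (fun x y a => smul_add _ _ _) (fun r x a => smul_comm _ _ _)
      (fun x a b => by rw [MulOpposite.op_add, add_smul])
      (fun r x a => by rw [MulOpposite.op_smul, smul_assoc])) v (w.coeff ρ))

end wreath

/-! ### Exactness, and the modules in the duality -/

section exact
variable {k : Type u} [CommRing k]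

/-- A pair of even morphisms of representations is a short exact sequence `0 → F → G → H → 0` if it
is short exact at every object. -/
def RepShortExact {C : SuperCat.{u, v, w} k} {F G H : (rep C).Obj}
    (α : (rep C).Hom F G) (β : (rep C).Hom G H) : Prop :=
  α ∈ homog k 0 ∧ β ∈ homog k 0 ∧ ∀ X : C.Obj,
    Function.Injective (α.1 X) ∧ Function.Exact (α.1 X) (β.1 X) ∧ Function.Surjective (β.1 X)

/-- A pair of even homomorphisms of left supermodules is a short exact sequence. -/
def ModShortExact {R : Type v} [Ring R] [Algebra k R] [SuperAlgebra k R] {L M N : LSMod.{u, v, w} k R}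
    (f : superLinearMaps L M) (g : superLinearMaps M N) : Prop :=
  f ∈ homog k 0 ∧ g ∈ homog k 0 ∧
    Function.Injective f.1 ∧ Function.Exact f.1 g.1 ∧ Function.Surjective g.1

/-- A functor from representations to left supermodules is exact if it preserves short exact
sequences. -/
def IsExactFunctor {C : SuperCat.{u, v, w} k} {R : Type x} [Ring R] [Algebra k R] [SuperAlgebra k R]
    (Ψ : SuperFunctor (rep C) (lsModCat.{u, x, y} k R)) : Prop :=
  ∀ (F G H : (rep C).Obj) (α : (rep C).Hom F G) (β : (rep C).Hom G H),
    RepShortExact α β → ModShortExact (Ψ.map α) (Ψ.map β)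

end exact

section duality
variable (k : Type u) [CommRing k] (A : Type u) [Ring A] [Algebra k A] [SuperAlgebra k A]

/-- `V^{⊗d}` for `V = A^n`, as a left supermodule over `S^A(n, d)`. -/
def tensorSpace (n d : ℕ) : LSMod.{u, u, u} k (SchurAlg k A n d) :=
  evalMod (tensorFunctor k A d) (freeObj k A n)

/-- The divided power functor `Γ^{d,n} = Hom(A^n, -)`, the hom functor of `A^n` in the category
`Γ^d` of evenly generated projective right `A`-supermodules. -/
abbrev gammaFunctor (n d : ℕ) : SuperFunctor (gammaCat d (evGenCat k A)) (sModCat.{u, u} k) :=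
  homRep (freeObj k A n)

/-- `Hom(Γ^{d,n}, ⊗^d)`, as a left supermodule over `S^A(n, d)`: an element `s` of `S^A(n, d)` acts
by `α ↦ (-1)^{|s| |α|} α ∘ h^s`, for the endomorphism `h^s : β ↦ (-1)^{|s| |β|} β ∘ s` of
`Γ^{d,n}`. -/
def homGammaTensor (n d : ℕ) : LSMod.{u, u, u + 1} k (SchurAlg k A n d) :=
  homObj (C := bigRep (gammaCat d (evGenCat k A))) (gammaFunctor k A n d)
    (precompHom (C := gammaCat d (evGenCat k A)) (freeObj k A n)) (precompHom_mem _)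
    (tensorFunctor k A d)

/-- The evaluation `α ↦ α_V(id_V)`, from `Hom(Γ^{d,n}, ⊗^d)` to `V^{⊗d}`, for `V = A^n`. -/
def evalAtId (n d : ℕ) (α : (homGammaTensor k A n d).carrier) : (tensorSpace k A n d).carrier :=
  (show natTrans (gammaFunctor k A n d) (tensorFunctor k A d) from α).1 (freeObj k A n)
    ((gammaCat d (evGenCat k A)).id (freeObj k A n))

end duality
end SuperPoly
end

universe u w

open SuperPoly

/-!
The functor `⊗^d` is a retract of the representable functor `Γ^{d,n} = h^V`, where `V = A^n` and
`d ≤ n`. Let `ω = e_1 ⊗ ⋯ ⊗ e_d` be the tensor of the first `d` basis vectors of `V`; it is even.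
By the Yoneda lemma it defines `Γ^{d,n} → ⊗^d`, `φ ↦ φ(ω)`. For `x` in `X` let `λ_i(x) : A^n → X`
be the homomorphism that maps `e_i` to `x` and the other basis vectors to zero. A section `θ : ⊗^d
→ Γ^{d,n}` maps `x_1 ⊗ ⋯ ⊗ x_d` to the symmetrization `∑_σ (λ_1(x_1) ⊗ ⋯ ⊗ λ_d(x_d)).σ`: at `ω`
only the summand with `σ = 1` survives, so that `θ(x)(ω) = x`; and `θ` is natural since
symmetrization is linear over invariant tensors. This is `tensorRetract`.

Everything else is formal for an even retract `T` of a representable functor `h^X`, with point `ω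
∈ T(X)` and even idempotent `e = θ(ω) ∈ End(X)` (`RepRetract`). The left module `T(X)` is the
retract `End(X) e` of `End(X)`, hence it is cyclic and projective. A morphism `η : T → F` is
determined by `η(ω)`, and the values that occur are exactly those in `e F(X)`
(`RepRetract.evalPoint_injective`, `RepRetract.evalPoint_desc`, `RepRetract.evalBilin_idem`).
Hence `Hom(T, F)` is an image of `F(X)`, which makes it finitely generated over the ground ring
when `F(X)` is, and `F ↦ Hom(T, F)` is exact.

For `T = ⊗^d` the idempotent is `∑_σ (E_{11} ⊗ ⋯ ⊗ E_{dd}).σ`, with matrix units `E_{ii}`, and `e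
V^{⊗d}` is the direct sum over `ρ` of the copies `(ω · A^{⊗d}).ρ` of `A^{⊗d}`. So `w ↦ ω · w` is a
bijection from the wreath product onto `e V^{⊗d}` (`coordTPow_wreathAct`, `idem_eq_wreathAct`),
and as the actions of `Γ^d Hom(X, Y)` and of the wreath product commute, this identifies the
endomorphisms of `⊗^d` with the wreath product (`wreathNat_bijective`). No homogeneous basis of
`A` is needed.
-/

noncomputable section

namespace SuperPoly

universe v x y

/-! ### The Yoneda lemma with the rule of signs -/

section yoneda
variable {k : Type u} [CommRing k] {C : SuperCat.{u, v, w} k}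

theorem sgn_mul_self (k : Type u) [CommRing k] (e : ZMod 2) : sgn k e * sgn k e = 1 := by
  have h : e + e = 0 := by revert e; decide
  rw [← sgn_add, h, sgn_zero]

/-- The naturality of `η`, solved for the value at `F(φ)(v)`. -/
theorem natTrans_apply_map {F G : SuperFunctor C (sModCat.{u, y} k)} {e j : ZMod 2}
    {η : natTrans F G} (hη : η ∈ homog k e) {X Y : C.Obj} {φ : C.Hom X Y} (hφ : φ ∈ homog k j)
    (v : (F.obj X).carrier) :
    (η.1 Y : (F.obj Y).carrier →ₗ[k] (G.obj Y).carrier)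
        ((F.map φ : (F.obj X).carrier →ₗ[k] (F.obj Y).carrier) v) =
      sgn k (j * e) • (G.map φ : (G.obj X).carrier →ₗ[k] (G.obj Y).carrier)
        ((η.1 X : (F.obj X).carrier →ₗ[k] (G.obj X).carrier) v) := by
  have h := LinearMap.congr_fun ((natural_of_mem hη).2 j X Y φ hφ) v
  change (G.map φ : (G.obj X).carrier →ₗ[k] (G.obj Y).carrier)
        ((η.1 X : (F.obj X).carrier →ₗ[k] (G.obj X).carrier) v) = sgn k (j * e) •
    (η.1 Y : (F.obj Y).carrier →ₗ[k] (G.obj Y).carrier)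
        ((F.map φ : (F.obj X).carrier →ₗ[k] (F.obj Y).carrier) v) at h
  rw [h, smul_smul, sgn_mul_self, one_smul]

/-- The evaluation map `(φ, v) ↦ F(φ)(v)` of a functor, as a bilinear map. -/
def evalBilin (F : SuperFunctor C (sModCat.{u, y} k)) (X Y : C.Obj) :
    C.Hom X Y →ₗ[k] (F.obj X).carrier →ₗ[k] (F.obj Y).carrier := F.map

theorem evalBilin_even (F : SuperFunctor C (sModCat.{u, y} k)) (X Y : C.Obj) :
    IsEven₂ (evalBilin F X Y) := fun i j φ hφ v hv => by
  rw [add_comm]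
  exact F.map_mem i φ hφ j v hv

/-- The natural transformation `h^X → F` attached to `v` in `F(X)` by the Yoneda lemma; it maps `φ`
to `(-1)^{|φ| |v|} F(φ)(v)`. -/
def yonedaNat (F : SuperFunctor C (sModCat.{u, v} k)) (X : C.Obj) :
    (F.obj X).carrier →ₗ[k] natTrans (homRep X) F :=
  LinearMap.codRestrict _ (LinearMap.pi fun Y => superTwist (evalBilin F X Y).flip) fun v => by
    refine homog_induction (k := k) (p := fun v : (F.obj X).carrier =>
      (LinearMap.pi fun Y => superTwist (evalBilin F X Y).flip :
        (F.obj X).carrier →ₗ[k] ∀ Y, (C.Hom X Y →ₗ[k] (F.obj Y).carrier)) v ∈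
        natTrans (homRep X) F) v ?_ ?_
    · intro a b ha hb
      rw [map_add]
      exact Submodule.add_mem _ ha hb
    · intro e v hv
      refine mem_natTrans (e := e) ⟨fun Y j φ hφ => ?_, fun j Y Z ψ hψ => ?_⟩
      · rw [add_comm]
        exact superTwist_mem (evalBilin_even F X Y) e j v hv φ hφ
      · suffices h : ∀ i, ∀ φ ∈ homog k (M := C.Hom X Y) i,
            evalBilin F Y Z ψ (superTwist (evalBilin F X Y).flip v φ) =
              sgn k (j * e) • superTwist (evalBilin F X Z).flip v (C.comp ψ φ) from ext_homog h
        intro i φ hφ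
        rw [superTwist_apply _ hv hφ, superTwist_apply _ hv (C.comp_mem _ _ _ hψ _ hφ),
          smul_smul, ← sgn_add, map_smul, LinearMap.flip_apply, LinearMap.flip_apply]
        have h1 : j * e + e * (j + i) = e * i := by
          rw [mul_add, mul_comm e j, ← add_assoc, CharTwo.add_self_eq_zero, zero_add]
        rw [h1]
        congr 1
        exact (LinearMap.congr_fun (F.map_comp ψ φ) v).symm

theorem yonedaNat_apply (F : SuperFunctor C (sModCat.{u, v} k)) (X Y : C.Obj)
    {i j : ZMod 2} {v : (F.obj X).carrier} (hv : v ∈ homog k i) {φ : C.Hom X Y}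
    (hφ : φ ∈ homog k j) :
    ((yonedaNat F X v).1 Y : C.Hom X Y →ₗ[k] (F.obj Y).carrier) φ =
      sgn k (i * j) • evalBilin F X Y φ v :=
  superTwist_apply _ hv hφ

/-- No sign occurs when an even morphism is evaluated. -/
theorem yonedaNat_apply_even (F : SuperFunctor C (sModCat.{u, v} k)) (X Y : C.Obj)
    (v : (F.obj X).carrier) {φ : C.Hom X Y} (hφ : φ ∈ homog k 0) :
    ((yonedaNat F X v).1 Y : C.Hom X Y →ₗ[k] (F.obj Y).carrier) φ = evalBilin F X Y φ v := by
  refine LinearMap.congr_fun (f := (superTwist (evalBilin F X Y).flip).flip φ)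
    (g := evalBilin F X Y φ) (ext_homog fun i a ha => ?_) v
  rw [LinearMap.flip_apply, superTwist_apply _ ha hφ, mul_zero, sgn_zero, one_smul]
  rfl

theorem yonedaNat_mem (F : SuperFunctor C (sModCat.{u, v} k)) (X : C.Obj) {i : ZMod 2}
    {v : (F.obj X).carrier} (hv : v ∈ homog k i) : yonedaNat F X v ∈ homog k i :=
  mem_homog_natTrans.mpr fun Y j φ hφ => by
    rw [add_comm]
    exact superTwist_mem (evalBilin_even F X Y) i j v hv φ hφ

/-- Evaluation of natural transformations at a point, as a linear map. -/
def evalPoint {F : SuperFunctor C (sModCat.{u, y} k)} (G : SuperFunctor C (sModCat.{u, y} k))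
    (X : C.Obj) (v : (F.obj X).carrier) : natTrans F G →ₗ[k] (G.obj X).carrier where
  toFun η := (η.1 X : (F.obj X).carrier →ₗ[k] (G.obj X).carrier) v
  map_add' _ _ := rfl
  map_smul' _ _ := rfl

theorem evalPoint_yonedaNat (F : SuperFunctor C (sModCat.{u, v} k)) (X : C.Obj)
    (v : (F.obj X).carrier) :
    evalPoint F X (C.id X : ((homRep X).obj X).carrier) (yonedaNat F X v) = v :=
  (yonedaNat_apply_even F X X v (C.id_mem X)).trans (LinearMap.congr_fun (F.map_id X) v)

theorem yonedaNat_evalPoint (F : SuperFunctor C (sModCat.{u, v} k)) (X : C.Obj)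
    (α : natTrans (homRep X) F) :
    yonedaNat F X (evalPoint F X (C.id X : ((homRep X).obj X).carrier) α) = α := by
  refine homog_induction (k := k) (p := fun α : natTrans (homRep X) F => yonedaNat F X
    (evalPoint F X (C.id X : ((homRep X).obj X).carrier) α) = α) α ?_ fun e α hα =>
      Subtype.ext <| funext fun Y => ?_
  · intro a b ha hb
    rw [map_add, map_add, ha, hb]
  suffices h : ∀ j, ∀ φ ∈ homog k (M := C.Hom X Y) j,
      evalPoint F Y φ (yonedaNat F X
        (evalPoint F X (C.id X : ((homRep X).obj X).carrier) α)) = evalPoint F Y φ α from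
    ext_homog h
  intro j φ hφ
  have h1 : evalPoint F X (C.id X : ((homRep X).obj X).carrier) α ∈ homog k e := by
    have := mem_homog_natTrans.mp hα X 0 (C.id X) (C.id_mem X)
    rwa [zero_add] at this
  have h2 := natTrans_apply_map hα (X := X) (Y := Y) (φ := φ) hφ (C.id X)
  refine (yonedaNat_apply F X Y h1 hφ).trans ?_
  rw [mul_comm]
  refine h2.symm.trans ?_
  exact congrArg _ (C.comp_id φ)

/-- `Hom(h^X, F)`, as a left supermodule over `End(X)`: an element `s` acts by precomposition with
the endomorphism `φ ↦ (-1)^{|s| |φ|} φ ∘ s` of `h^X`. -/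
def homRepMod (F : SuperFunctor C (sModCat.{u, v} k)) (X : C.Obj) : LSMod k (C.End X) :=
  homObj (C := bigRep C) (homRep X) (precompHom X) (precompHom_mem X) F

/-- The Yoneda lemma: evaluation at the identity is an isomorphism of left `End(X)`-supermodules
from `Hom(h^X, F)` to `F(X)`. -/
def yonedaEquiv (F : SuperFunctor C (sModCat.{u, v} k)) (X : C.Obj) :
    (homRepMod F X).carrier ≃ₗ[C.End X]
      (evalMod F X).carrier where
  toFun α := evalPoint F X (C.id X : ((homRep X).obj X).carrier) α
  map_add' α β := map_add _ _ _
  map_smul' s α := by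
    change evalPoint F X (C.id X : ((homRep X).obj X).carrier)
      (superTwist (natComp (homRep X) (homRep X) F).flip (precompNat X s) α) =
      evalBilin F X X s (evalPoint F X (C.id X : ((homRep X).obj X).carrier) α)
    refine LinearMap.congr_fun₂ (f := ((superTwist (natComp (homRep X) (homRep X) F).flip) ∘ₗ
      precompNat X).compr₂ (evalPoint F X (C.id X : ((homRep X).obj X).carrier)))
      (g := (evalBilin F X X).compl₂ (evalPoint F X (C.id X : ((homRep X).obj X).carrier)))
      (ext_homog₂ fun i j s hs α hα => ?_) s α
    rw [LinearMap.compr₂_apply, LinearMap.compl₂_apply, LinearMap.comp_apply,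
      superTwist_apply _ (precompNat_mem X i s hs) hα, map_smul, LinearMap.flip_apply]
    have h0 : superTwist (C.comp (X := X) (Y := X) (Z := X)).flip s (C.id X) = s := by
      rw [superTwist_apply _ hs (C.id_mem X), mul_zero, sgn_zero, one_smul]
      exact C.id_comp s
    have h1 : evalPoint F X (C.id X : ((homRep X).obj X).carrier)
        (natComp (homRep X) (homRep X) F α (precompNat X s)) = evalPoint F X s α :=
      congrArg (fun t => evalPoint F X t α) h0
    have h2 := natTrans_apply_map hα (X := X) (Y := X) (φ := s) hs (C.id X)
    rw [h1]
    have h3 : evalPoint F X s α = sgn k (i * j) • evalBilin F X X s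
        (evalPoint F X (C.id X : ((homRep X).obj X).carrier) α) :=
      (congrArg (fun t => evalPoint F X t α) (C.comp_id s).symm).trans h2
    rw [h3, smul_smul, sgn_mul_self, one_smul]
  invFun v := yonedaNat F X v
  left_inv := yonedaNat_evalPoint F X
  right_inv := evalPoint_yonedaNat F X

end yoneda

/-! ### Retracts of representable functors -/

/-- If `g : N → P` is a surjective even map, then homogeneous elements of `P` lift to homogeneous
elements of `N`. -/
theorem exists_homog_lift {k : Type u} [CommRing k] {N P : Type*} [AddCommGroup N] [Module k N]
    [SuperModule k N] [AddCommGroup P] [Module k P] [SuperModule k P] (g : N → P)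
    (hadd : ∀ a b, g (a + b) = g a + g b)
    (hg : ∀ i, ∀ n ∈ homog k (M := N) i, g n ∈ homog k i) (hs : Function.Surjective g)
    {e : ZMod 2} {p : P} (hp : p ∈ homog k e) : ∃ n ∈ homog k (M := N) e, g n = p := by
  obtain ⟨x, rfl⟩ := hs p
  refine ⟨proj k e x, proj_mem _ _, ?_⟩
  have h := proj_of_mem hp
  conv_lhs at h => rw [← sum_proj (k := k) x, sum_zmod, hadd, map_add,
    proj_of_mem_ite (hg 0 _ (proj_mem _ _)), proj_of_mem_ite (hg 1 _ (proj_mem _ _))]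
  rw [← h]
  rcases zmod_two e with rfl | rfl <;> simp

/-- Data exhibiting a functor `T` as an even retract of the representable functor `h^X`: a section
`sec : T → h^X` of the morphism `h^X → T` given by an even element `point` of `T(X)`. -/
structure RepRetract {k : Type u} [CommRing k] {C : SuperCat.{u, v, w} k}
    (T : SuperFunctor C (sModCat.{u, v} k)) (X : C.Obj) where
  point : (T.obj X).carrier
  point_mem : point ∈ homog k 0
  sec : natTrans T (homRep X)
  sec_mem : sec ∈ homog k 0
  map_sec : ∀ (Y : C.Obj) (v : (T.obj Y).carrier),
    evalBilin T X Y ((sec.1 Y : (T.obj Y).carrier →ₗ[k] C.Hom X Y) v) point = v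

namespace RepRetract
variable {k : Type u} [CommRing k] {C : SuperCat.{u, v, w} k}
  {T : SuperFunctor C (sModCat.{u, v} k)} {X : C.Obj} (ρ : RepRetract T X)

/-- The components of the section `T → h^X`. -/
def secMap (Y : C.Obj) : (T.obj Y).carrier →ₗ[k] C.Hom X Y := ρ.sec.1 Y

theorem secMap_mem (Y : C.Obj) {i : ZMod 2} {v : (T.obj Y).carrier} (hv : v ∈ homog k i) :
    ρ.secMap Y v ∈ homog k i := by
  have := mem_homog_natTrans.mp ρ.sec_mem Y i v hv
  rwa [add_zero] at this

theorem evalBilin_secMap (Y : C.Obj) (v : (T.obj Y).carrier) :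
    evalBilin T X Y (ρ.secMap Y v) ρ.point = v := ρ.map_sec Y v

theorem secMap_evalBilin {Y Z : C.Obj} (φ : C.Hom Y Z) (v : (T.obj Y).carrier) :
    ρ.secMap Z (evalBilin T Y Z φ v) = C.comp φ (ρ.secMap Y v) := by
  refine homog_induction (k := k) (p := fun φ : C.Hom Y Z =>
    ρ.secMap Z (evalBilin T Y Z φ v) = C.comp φ (ρ.secMap Y v)) φ ?_ ?_
  · intro a b ha hb
    rw [map_add, LinearMap.add_apply, map_add, ha, hb, LinearMap.map_add₂]
  · intro j φ hφ
    have := natTrans_apply_map ρ.sec_mem hφ v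
    rw [mul_zero, sgn_zero, one_smul] at this
    exact this

/-- The idempotent endomorphism of `X` that corresponds to the retract. -/
def idem : C.Hom X X := ρ.secMap X ρ.point

theorem idem_mem : ρ.idem ∈ homog k 0 := ρ.secMap_mem X ρ.point_mem

theorem evalBilin_idem (F : SuperFunctor C (sModCat.{u, v} k)) (η : natTrans T F) :
    evalBilin F X X ρ.idem (evalPoint F X ρ.point η) = evalPoint F X ρ.point η := by
  -- Evaluate the naturality of `η` at the idempotent, which is even and fixes the point.
  refine homog_induction (k := k) (p := fun η : natTrans T F =>
    evalBilin F X X ρ.idem (evalPoint F X ρ.point η) = evalPoint F X ρ.point η) η ?_ ?_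
  · intro a b ha hb
    rw [map_add, map_add, ha, hb]
  · intro e η hη
    have h := natTrans_apply_map hη ρ.idem_mem ρ.point
    rw [zero_mul, sgn_zero, one_smul] at h
    exact h.symm.trans <| congrArg (fun t => evalPoint F X t η) (ρ.evalBilin_secMap X ρ.point)

/-- Every `v` in `T(Y)` is the image of the point under `sec(v)`, so naturality gives `η_Y(v)`. The
signs require homogeneous components, which vanish at the point as well since the point is even. -/
theorem eq_zero_of_evalPoint {F : SuperFunctor C (sModCat.{u, v} k)} {η : natTrans T F}
    (h : evalPoint F X ρ.point η = 0) : η = 0 := by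
  have h0 : ∀ e, evalPoint F X ρ.point (proj k e η) = 0 := fun e => by
    have h1 : ∀ i, evalPoint F X ρ.point (proj k i η) ∈ homog k i := fun i => by
      have := mem_homog_natTrans.mp (proj_mem i η) X 0 ρ.point ρ.point_mem
      rwa [zero_add] at this
    rw [← sum_proj (k := k) η, map_sum] at h
    have h2 := congrArg (proj k e) h
    rw [map_sum, map_zero, Finset.sum_eq_single e] at h2
    · rwa [proj_of_mem (h1 e)] at h2
    · intro i _ hi
      exact proj_of_mem_ne (h1 i) hi
    · simp
  rw [← sum_proj (k := k) η]
  refine Finset.sum_eq_zero fun e _ => Subtype.ext <| funext fun Y => ext_homog fun j v hv => ?_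
  have h3 := natTrans_apply_map (proj_mem e η) (ρ.secMap_mem Y hv) ρ.point
  have h4 := ρ.evalBilin_secMap Y v
  have h5 : evalPoint F Y v (proj k e η) = sgn k (j * e) •
      evalBilin F X Y (ρ.secMap Y v) (evalPoint F X ρ.point (proj k e η)) :=
    (congrArg (fun t => evalPoint F Y t (proj k e η)) h4.symm).trans h3
  rw [h0, map_zero, smul_zero] at h5
  exact h5

/-- A natural transformation out of a retract of `h^X` is determined by its value at the point of
`T(X)`. -/
theorem evalPoint_injective (F : SuperFunctor C (sModCat.{u, v} k)) :
    Function.Injective (evalPoint F X ρ.point) :=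
  (injective_iff_map_eq_zero _).mpr fun _ h => ρ.eq_zero_of_evalPoint h

/-- The natural transformation `T → F` that maps the point of `T(X)` to the image of `v` under the
idempotent of the retract. -/
def desc (F : SuperFunctor C (sModCat.{u, v} k)) : (F.obj X).carrier →ₗ[k] natTrans T F :=
  (natComp T (homRep X) F).flip ρ.sec ∘ₗ yonedaNat F X

theorem evalPoint_desc (F : SuperFunctor C (sModCat.{u, v} k)) (v : (F.obj X).carrier) :
    evalPoint F X ρ.point (ρ.desc F v) = evalBilin F X X ρ.idem v :=
  yonedaNat_apply_even F X X v ρ.idem_mem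

theorem desc_evalPoint (F : SuperFunctor C (sModCat.{u, v} k)) (η : natTrans T F) :
    ρ.desc F (evalPoint F X ρ.point η) = η :=
  ρ.evalPoint_injective F <| (ρ.evalPoint_desc F _).trans (ρ.evalBilin_idem F η)

/-- The section `T(X) → End(X)`. -/
def secEnd : (evalMod T X).carrier →ₗ[k] C.End X := ρ.secMap X

theorem secEnd_smul_point (v : (evalMod T X).carrier) :
    ρ.secEnd v • (show (evalMod T X).carrier from ρ.point) = v := ρ.evalBilin_secMap X v

theorem secEnd_smul (s : C.End X) (v : (evalMod T X).carrier) :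
    ρ.secEnd (s • v) = s * ρ.secEnd v := ρ.secMap_evalBilin (Y := X) (Z := X) s v

theorem finite_evalMod (ρ : RepRetract T X) : Module.Finite (C.End X) (evalMod T X).carrier :=
  Module.Finite.of_surjective
    (LinearMap.toSpanSingleton (C.End X) (evalMod T X).carrier
      (show (evalMod T X).carrier from ρ.point)) fun v => ⟨ρ.secEnd v, ρ.secEnd_smul_point v⟩

theorem isSuperProjective_evalMod (ρ : RepRetract T X) :
    IsSuperProjective.{u, v, v, x} k (C.End X) (evalMod T X).carrier := by
  intro N P _ _ _ _ _ _ _ _ _ _ _ _ g f hg hf hs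
  obtain ⟨n, hn, hgn⟩ := exists_homog_lift (k := k) g (map_add g) hg hs (hf 0 _ ρ.point_mem)
  refine ⟨{ toFun := fun v => ρ.secEnd v • n
            map_add' := fun v v' => by rw [map_add, add_smul]
            map_smul' := fun s v => by rw [ρ.secEnd_smul, mul_smul]; rfl },
    fun i v hv => ?_, LinearMap.ext fun v => ?_⟩
  · have := GradedAction.smul_mem (k := k) (R := C.End X) (a := ρ.secEnd v)
      (ρ.secMap_mem X hv) hn
    rwa [add_zero] at this
  · change g (ρ.secEnd v • n) = f v
    rw [map_smul, hgn]
    exact (map_smul f _ _).symm.trans (congrArg f (ρ.secEnd_smul_point v))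

section exactness
variable {F G H : SuperFunctor C (sModCat.{u, v} k)}

theorem evalBilin_idem_natural (ρ : RepRetract T X) {γ : natTrans F G} (hγ : γ ∈ homog k 0)
    (v : (F.obj X).carrier) :
    evalPoint G X (evalBilin F X X ρ.idem v) γ = evalBilin G X X ρ.idem (evalPoint G X v γ) := by
  have := natTrans_apply_map hγ ρ.idem_mem v
  rwa [mul_zero, sgn_zero, one_smul] at this

/-- Postcomposition with an even `γ` reaches every `η` whose value at the point is in the image
of `γ_X`: the preimage need not be fixed by the idempotent, since `desc` applies it. -/
theorem natComp_desc (ρ : RepRetract T X) {γ : natTrans F G} (hγ : γ ∈ homog k 0)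
    {η : natTrans T G} {v : (F.obj X).carrier}
    (hv : evalPoint G X v γ = evalPoint G X ρ.point η) :
    natComp T F G γ (ρ.desc F v) = η := by
  refine ρ.evalPoint_injective G ?_
  change evalPoint G X (evalPoint F X ρ.point (ρ.desc F v)) γ = _
  rw [ρ.evalPoint_desc, ρ.evalBilin_idem_natural hγ, hv, ρ.evalBilin_idem]

theorem natComp_injective (ρ : RepRetract T X) {γ : natTrans F G}
    (h : Function.Injective fun v => evalPoint G X v γ) :
    Function.Injective (natComp T F G γ) := fun _ _ hη =>
  ρ.evalPoint_injective F (h (congrArg (evalPoint G X ρ.point) hη))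

theorem natComp_surjective (ρ : RepRetract T X) {γ : natTrans F G} (hγ : γ ∈ homog k 0)
    (h : Function.Surjective fun v => evalPoint G X v γ) :
    Function.Surjective (natComp T F G γ) := fun η =>
  (h (evalPoint G X ρ.point η)).elim fun v hv => ⟨ρ.desc F v, ρ.natComp_desc hγ hv⟩

theorem natComp_exact (ρ : RepRetract T X) {α : natTrans F G} {β : natTrans G H}
    (hα : α ∈ homog k 0)
    (h : Function.Exact (fun v => evalPoint G X v α) fun v => evalPoint H X v β) :
    Function.Exact (natComp T F G α) (natComp T G H β) := fun η => by
  constructor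
  · intro hη
    obtain ⟨v, hv⟩ := (h (evalPoint G X ρ.point η)).mp (congrArg (evalPoint H X ρ.point) hη)
    exact ⟨ρ.desc F v, ρ.natComp_desc hα hv⟩
  · rintro ⟨θ, rfl⟩
    exact ρ.evalPoint_injective H ((h _).mpr ⟨evalPoint F X ρ.point θ, rfl⟩)

end exactness

end RepRetract

/-! ### Hom functors of retracts of representable functors -/

section representations
variable {k : Type u} [CommRing k] {C : SuperCat.{u, v, w} k} {T : (rep C).Obj} {X : C.Obj}
  {R : Type x} [Ring R] [Algebra k R] [SuperAlgebra k R]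
  (Φ : R →ₐ[k] SuperOpposite k ((rep C).End T))
  (hΦ : ∀ i, ∀ r ∈ homog k (M := R) i, Φ r ∈ homog k i)

/-- `Hom(T, F)` is finitely generated already over the ground ring, as an image of `F(X)`. -/
theorem RepRetract.finite_homFunctor (ρ : RepRetract T.1 X) (F : (rep C).Obj) :
    Module.Finite R ((homFunctor T Φ hΦ).obj F).carrier := by
  have hF := (F.2 X).1
  have h : Module.Finite k ((homFunctor T Φ hΦ).obj F).carrier :=
    Module.Finite.of_surjective (M := (F.1.obj X).carrier) (P := natTrans T.1 F.1) (ρ.desc F.1)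
      fun η => ⟨_, ρ.desc_evalPoint F.1 η⟩
  exact Module.Finite.of_restrictScalars_finite k R _

theorem RepRetract.isExactFunctor_homFunctor (ρ : RepRetract T.1 X) :
    IsExactFunctor (homFunctor T Φ hΦ) := by
  intro F G H α β ⟨hα, hβ, h⟩
  obtain ⟨hinj, hex, hsurj⟩ := h X
  have h1 := ρ.natComp_injective hinj
  have h2 := ρ.natComp_exact hα hex
  have h3 := ρ.natComp_surjective hβ hsurj
  exact ⟨(homFunctor T Φ hΦ).map_mem 0 α hα, (homFunctor T Φ hΦ).map_mem 0 β hβ, h1, h2, h3⟩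

end representations

/-! ### Symmetrization and tensor products of even maps -/

section signedActions
variable {k : Type u} [CommRing k] {d : ℕ}
  {M : Type v} [AddCommGroup M] [Module k M] [SuperModule k M]
  {N : Type w} [AddCommGroup N] [Module k N] [SuperModule k N]
  {P : Type x} [AddCommGroup P] [Module k P] [SuperModule k P]

/-- The sum of the images of a tensor under the signed permutations. -/
def symmetrize (k : Type u) [CommRing k] (M : Type v) [AddCommGroup M] [Module k M]
    [SuperModule k M] (d : ℕ) : TPow k M d →ₗ[k] divPow k M d :=
  LinearMap.codRestrict _ (∑ σ, permAct σ) fun t τ => by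
    rw [LinearMap.sum_apply, map_sum]
    simp_rw [← permAct_mul]
    exact Equiv.sum_comp (Equiv.mulRight τ) fun σ => permAct σ t

theorem symmetrize_val (t : TPow k M d) : (symmetrize k M d t).1 = ∑ σ, permAct σ t :=
  LinearMap.sum_apply _ _ _

theorem symmetrize_mem {e : ZMod 2} {t : TPow k M d} (ht : t ∈ homog k e) :
    symmetrize k M d t ∈ homog k e := by
  change (symmetrize k M d t).1 ∈ homog k e
  rw [symmetrize_val]
  exact Submodule.sum_mem _ fun σ _ => permAct_mem σ ht

/-- The symmetrization is linear over invariant tensors. -/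
theorem symmetrize_tensorMap₂ {μ : M →ₗ[k] N →ₗ[k] P} (hμ : IsEven₂ μ) {s : TPow k M d}
    (hs : s ∈ divPow k M d) (t : TPow k N d) :
    (symmetrize k P d (tensorMap₂ d μ s t)).1 = tensorMap₂ d μ s (symmetrize k N d t).1 := by
  simp_rw [symmetrize_val, map_sum, permAct_tensorMap₂ _ hμ]
  exact Finset.sum_congr rfl fun σ _ => by rw [hs σ]

theorem tensorMap₂_permAct_left {μ : M →ₗ[k] N →ₗ[k] P} (hμ : IsEven₂ μ)
    (σ : Equiv.Perm (Fin d)) (s : TPow k M d) (t : TPow k N d) :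
    tensorMap₂ d μ (permAct σ s) t = permAct σ (tensorMap₂ d μ s (permAct σ⁻¹ t)) := by
  rw [permAct_tensorMap₂ σ hμ, ← permAct_mul, inv_mul_cancel, permAct_one]

theorem piTensorMap_mem {f : Fin d → M →ₗ[k] N}
    (hf : ∀ i e, ∀ m ∈ homog k (M := M) e, f i m ∈ homog k e) {e : ZMod 2} {t : TPow k M d}
    (ht : t ∈ homog k e) : (PiTensorProduct.map f t : TPow k N d) ∈ homog k e := by
  refine tensor_homog_induction ht _ (PiTensorProduct.map f) fun ε m hm he => ?_
  rw [PiTensorProduct.map_tprod, ← he]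
  exact tprod_mem fun i => hf i _ _ (hm i)

/-- No sign occurs when the second factor is a tensor of even elements. -/
theorem tensorMap₂_tprod_even (μ : M →ₗ[k] N →ₗ[k] P) (t : TPow k M d) {n : Fin d → N}
    (hn : ∀ i, n i ∈ homog k 0) :
    tensorMap₂ d μ t (PiTensorProduct.tprod k n) =
      PiTensorProduct.map (fun i => μ.flip (n i)) t := by
  refine LinearMap.congr_fun (f := (tensorMap₂ d μ).flip (PiTensorProduct.tprod k n))
    (g := PiTensorProduct.map fun i => μ.flip (n i)) (ext_tensor fun ε m hm => ?_) t
  rw [LinearMap.flip_apply, tensorMap₂_tprod μ (δ := fun _ => 0) hm hn,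
    PiTensorProduct.map_tprod]
  simp [shuffleSign, sgn_zero]

/-- No sign occurs when the first factor is a tensor of even elements. -/
theorem tensorMap₂_even_tprod (μ : M →ₗ[k] N →ₗ[k] P) {m : Fin d → M}
    (hm : ∀ i, m i ∈ homog k 0) (t : TPow k N d) :
    tensorMap₂ d μ (PiTensorProduct.tprod k m) t =
      PiTensorProduct.map (fun i => μ (m i)) t := by
  refine LinearMap.congr_fun (f := tensorMap₂ d μ (PiTensorProduct.tprod k m))
    (g := PiTensorProduct.map fun i => μ (m i)) (ext_tensor fun ε n hn => ?_) t
  rw [tensorMap₂_tprod μ (ε := fun _ => 0) hm hn, PiTensorProduct.map_tprod]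
  simp [shuffleSign, sgn_zero]

/-- If `f_i ∘ g_j = 0` for `i ≠ j` and `f_i ∘ g_i = id`, then the tensor product of the `f_i`
applied to `(g_1 ⊗ ⋯ ⊗ g_d)(t).σ` vanishes unless `σ = 1`. -/
theorem map_permAct_map {f : Fin d → N →ₗ[k] P} {g : Fin d → P →ₗ[k] N}
    (hg : ∀ i e, ∀ m ∈ homog k (M := P) e, g i m ∈ homog k e)
    (h1 : ∀ i m, f i (g i m) = m) (h2 : ∀ i j m, i ≠ j → f i (g j m) = 0)
    (σ : Equiv.Perm (Fin d)) (t : TPow k P d) :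
    PiTensorProduct.map f (permAct σ (PiTensorProduct.map g t : TPow k N d)) =
      if σ = 1 then t else 0 := by
  split_ifs with h
  · subst h
    rw [permAct_one, ← LinearMap.comp_apply, ← PiTensorProduct.map_comp]
    have : (fun i => f i ∘ₗ g i) = fun _ => LinearMap.id :=
      funext fun i => LinearMap.ext fun m => h1 i m
    rw [this, PiTensorProduct.map_id, LinearMap.id_apply]
  · refine LinearMap.congr_fun (f := PiTensorProduct.map f ∘ₗ permAct σ ∘ₗ PiTensorProduct.map g)
      (g := 0) (ext_tensor fun ε m hm => ?_) t
    rw [LinearMap.comp_apply, LinearMap.comp_apply, PiTensorProduct.map_tprod,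
      permAct_tprod σ (ε := ε) fun i => hg i _ _ (hm i), map_smul, PiTensorProduct.map_tprod]
    obtain ⟨i, hi⟩ : ∃ i, σ i ≠ i := not_forall.mp fun h' => h (Equiv.ext h')
    rw [(PiTensorProduct.tprod k).map_coord_zero i (h2 i (σ i) _ hi.symm), smul_zero]
    rfl

end signedActions

/-! ### The tensor power functor as a retract of `Γ^{d,n}` -/

section tensorRetract
variable {k : Type u} [CommRing k] {A : Type u} [Ring A] [Algebra k A] [SuperAlgebra k A]
  {n d : ℕ}

/-- The right action `(x, a) ↦ x a` of `A` on a right `A`-supermodule, as a bilinear map. -/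
def actMap {X : Type w} [AddCommGroup X] [Module k X] [Module Aᵐᵒᵖ X] [IsScalarTower k Aᵐᵒᵖ X] :
    X →ₗ[k] A →ₗ[k] X :=
  LinearMap.mk₂ k (fun (x : X) (a : A) => MulOpposite.op a • x)
    (fun x y a => smul_add _ _ _) (fun r x a => smul_comm _ _ _)
    (fun x a b => by rw [MulOpposite.op_add, add_smul])
    (fun r x a => by rw [MulOpposite.op_smul, smul_assoc])

theorem actMap_even {X : Type w} [AddCommGroup X] [Module k X] [Module Aᵐᵒᵖ X]
    [IsScalarTower k Aᵐᵒᵖ X] [SuperModule k X] [GradedAction k Aᵐᵒᵖ X] :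
    IsEven₂ (actMap (k := k) (A := A) (X := X)) := fun i j x hx a ha => by
  rw [add_comm]
  exact GradedAction.smul_mem (R := Aᵐᵒᵖ) (a := MulOpposite.op a) ha hx

/-- For `x` in `X`, the homomorphism `A^n → X` that maps the `i`-th basis vector to `x` and the
other basis vectors to zero. -/
def coordHom (X : EvGenProj k A) (i : Fin n) :
    X.carrier →ₗ[k] ((freeObj k A n).carrier →ₗ[Aᵐᵒᵖ] X.carrier) where
  toFun x :=
    { toFun := fun a : Fin n → A => MulOpposite.op (a i) • x
      map_add' := fun a b => add_smul (MulOpposite.op (a i)) (MulOpposite.op (b i)) x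
      map_smul' := fun r a => mul_smul r (MulOpposite.op (a i)) x }
  map_add' _ _ := LinearMap.ext fun _ => smul_add _ _ _
  map_smul' c x := LinearMap.ext fun a : Fin n → A => (smul_comm c (MulOpposite.op (a i)) x).symm

theorem coordHom_mem (X : EvGenProj k A) (i : Fin n) (e : ZMod 2) (x : X.carrier)
    (hx : x ∈ homog k e) : coordHom X i x ∈ homog k e := fun _ (_ : Fin n → A) ha =>
  GradedAction.smul_mem (R := Aᵐᵒᵖ) (mem_homog_op.mpr (mem_homog_pi.mp ha i)) hx

/-- The inclusion of `A` into `A^n` as the `i`-th summand. -/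
def inclMap (k : Type u) [CommRing k] (A : Type u) [Ring A] [Algebra k A] [SuperAlgebra k A]
    {n : ℕ} (i : Fin n) : A →ₗ[k] (freeObj k A n).carrier :=
  LinearMap.single k (fun _ : Fin n => A) i

/-- The projection of `A^n` onto the `i`-th summand. -/
def projMap (k : Type u) [CommRing k] (A : Type u) [Ring A] [Algebra k A] [SuperAlgebra k A]
    {n : ℕ} (i : Fin n) : (freeObj k A n).carrier →ₗ[k] A :=
  LinearMap.proj (φ := fun _ : Fin n => A) i

theorem inclMap_mem (i : Fin n) (e : ZMod 2) (a : A) (ha : a ∈ homog k e) :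
    inclMap k A i a ∈ homog k e := mem_homog_pi.mpr fun j => by
  change (Pi.single i a : Fin n → A) j ∈ homog k e
  by_cases h : j = i
  · subst h; rwa [Pi.single_eq_same]
  · rw [Pi.single_eq_of_ne h]; exact Submodule.zero_mem _

theorem projMap_inclMap (i : Fin n) (a : A) : projMap k A i (inclMap k A i a) = a :=
  Pi.single_eq_same (M := fun _ : Fin n => A) i a

theorem projMap_inclMap_ne {i j : Fin n} (h : i ≠ j) (a : A) :
    projMap k A i (inclMap k A j a) = 0 :=
  Pi.single_eq_of_ne (M := fun _ : Fin n => A) h a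

/-- The basis vectors of `A^n`. -/
def basisVec (k : Type u) [CommRing k] (A : Type u) [Ring A] [Algebra k A] [SuperAlgebra k A]
    {n : ℕ} (i : Fin n) : (freeObj k A n).carrier := inclMap k A i 1

theorem basisVec_mem (i : Fin n) : basisVec k A i ∈ homog k 0 :=
  inclMap_mem i 0 1 SuperAlgebra.one_mem

theorem actMap_basisVec (i : Fin n) :
    actMap (k := k) (A := A) (basisVec k A i) = inclMap k A i := by
  refine LinearMap.ext fun a => ?_
  change (fun j => (Pi.single i (1 : A) : Fin n → A) j * a) = Pi.single i a
  funext j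
  by_cases h : j = i
  · subst h; rw [Pi.single_eq_same, Pi.single_eq_same, one_mul]
  · rw [Pi.single_eq_of_ne h, Pi.single_eq_of_ne h, zero_mul]

theorem coordHom_basisVec (X : EvGenProj k A) (i j : Fin n) (x : X.carrier) :
    (coordHom X i x : (freeObj k A n).carrier →ₗ[Aᵐᵒᵖ] X.carrier) (basisVec k A j) =
      if i = j then x else 0 := by
  refine (congrArg (fun a : A => MulOpposite.op a • x)
    (show projMap k A i (inclMap k A j 1) = if i = j then 1 else 0 from ?_)).trans ?_
  · split_ifs with h
    · subst h; exact projMap_inclMap i 1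
    · exact projMap_inclMap_ne h 1
  · split_ifs <;> simp

/-- The first `d` of the `n` indices, for `d ≤ n`. -/
abbrev idx (hnd : d ≤ n) (i : Fin d) : Fin n := Fin.castLE hnd i

/-- The tensor `e_1 ⊗ ⋯ ⊗ e_d` of the first `d` basis vectors of `A^n`. -/
def basePoint (k : Type u) [CommRing k] (A : Type u) [Ring A] [Algebra k A] [SuperAlgebra k A]
    {n d : ℕ} (hnd : d ≤ n) : TPow k (freeObj k A n).carrier d :=
  PiTensorProduct.tprod k fun i => basisVec k A (idx hnd i)

theorem basePoint_mem (hnd : d ≤ n) : basePoint k A hnd ∈ homog k 0 := by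
  have := tprod_mem (k := k) (ε := fun _ => 0) fun i => basisVec_mem (k := k) (A := A) (idx hnd i)
  rwa [Finset.sum_const_zero] at this

/-- The map `x_1 ⊗ ⋯ ⊗ x_d ↦ f_1 ⊗ ⋯ ⊗ f_d`, where `f_i : A^n → X` maps the `i`-th basis vector
to `x_i` and the other basis vectors to zero. -/
def coordTensor (hnd : d ≤ n) (X : EvGenProj k A) :
    TPow k X.carrier d →ₗ[k] TPow k ((freeObj k A n).carrier →ₗ[Aᵐᵒᵖ] X.carrier) d :=
  PiTensorProduct.map fun i => coordHom X (idx hnd i)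

/-- Composition of homomorphisms of right supermodules, as a bilinear map. -/
def linCompMap (W X Y : EvGenProj k A) : (X.carrier →ₗ[Aᵐᵒᵖ] Y.carrier) →ₗ[k]
    (W.carrier →ₗ[Aᵐᵒᵖ] X.carrier) →ₗ[k] (W.carrier →ₗ[Aᵐᵒᵖ] Y.carrier) :=
  (evGenCat k A).comp (X := W) (Y := X) (Z := Y)

theorem linCompMap_even (W X Y : EvGenProj k A) : IsEven₂ (linCompMap W X Y) :=
  (evGenCat k A).comp_mem (X := W) (Y := X) (Z := Y)

theorem coordTensor_tensorMap₂ (hnd : d ≤ n) {X Y : EvGenProj k A}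
    (f : TPow k (X.carrier →ₗ[Aᵐᵒᵖ] Y.carrier) d) (t : TPow k X.carrier d) :
    coordTensor hnd Y (tensorMap₂ d (evalMap X Y) f t) =
      tensorMap₂ d (linCompMap (freeObj k A n) X Y) f
        (coordTensor hnd X t) := by
  have h : (tensorMap₂ d (evalMap X Y)).compr₂ (coordTensor (A := A) hnd Y) =
      (tensorMap₂ d (linCompMap (freeObj k A n) X Y)).compl₂ (coordTensor hnd X) := by
    refine ext_tensor₂ (k := k) (M := X.carrier →ₗ[Aᵐᵒᵖ] Y.carrier) (N := X.carrier)
      (Q := TPow k ((freeObj k A n).carrier →ₗ[Aᵐᵒᵖ] Y.carrier) d) fun ε f δ x hf hx => ?_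
    rw [LinearMap.compr₂_apply, LinearMap.compl₂_apply, tensorMap₂_tprod _ hf hx, map_smul,
      coordTensor, coordTensor, PiTensorProduct.map_tprod, PiTensorProduct.map_tprod,
      tensorMap₂_tprod _ hf fun i => coordHom_mem X (idx hnd i) _ _ (hx i)]
    congr 2
    funext i
    exact LinearMap.ext fun a : Fin n → A =>
      ((f i).map_smul (MulOpposite.op (a (idx hnd i))) (x i)).symm
  exact LinearMap.congr_fun₂ h f t

theorem evalMap_symmetrize_coordTensor (hnd : d ≤ n) (X : EvGenProj k A)
    (t : TPow k X.carrier d) :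
    tensorMap₂ d (evalMap (freeObj k A n) X)
      (symmetrize k _ d (coordTensor hnd X t)).1 (basePoint k A hnd) = t := by
  rw [basePoint, tensorMap₂_tprod_even _ _ fun i => basisVec_mem (idx hnd i), symmetrize_val,
    map_sum]
  have h : ∀ σ : Equiv.Perm (Fin d), _ = if σ = 1 then t else 0 := fun σ =>
    map_permAct_map (k := k) (P := X.carrier)
      (f := fun i => (evalMap (freeObj k A n) X).flip (basisVec k A (idx hnd i)))
      (g := fun i => coordHom X (idx hnd i)) (fun i => coordHom_mem X (idx hnd i))
      (fun i x => (coordHom_basisVec X _ _ x).trans (if_pos rfl))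
      (fun i j x hij => (coordHom_basisVec X _ _ x).trans
        (if_neg fun h => hij ((Fin.castLE_injective hnd h).symm))) σ t
  refine (Finset.sum_congr rfl fun σ _ => h σ).trans ?_
  rw [Finset.sum_ite_eq' Finset.univ (1 : Equiv.Perm (Fin d)) fun _ => t,
    if_pos (Finset.mem_univ _)]

/-- For `d ≤ n`, the functor `⊗^d` is a retract of `Γ^{d,n}`: the section maps `x_1 ⊗ ⋯ ⊗ x_d` to
the symmetrization of `f_1 ⊗ ⋯ ⊗ f_d`, where `f_i : A^n → X` maps the `i`-th basis vector to `x_i`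
and the other basis vectors to zero. -/
def tensorRetract (hnd : d ≤ n) : RepRetract (tensorFunctor k A d) (freeObj k A n) where
  point := basePoint k A hnd
  point_mem := basePoint_mem hnd
  sec := ⟨fun X => symmetrize k _ d ∘ₗ coordTensor hnd X, mem_natTrans (e := 0)
    ⟨fun X j t ht => by
      rw [add_zero]
      exact symmetrize_mem (piTensorMap_mem (fun i => coordHom_mem X (idx hnd i)) ht),
    fun j X Y φ hφ => LinearMap.ext fun t => by
      rw [mul_zero, sgn_zero, one_smul]
      refine Subtype.ext ?_
      exact (symmetrize_tensorMap₂ (linCompMap_even _ X Y) φ.2 (coordTensor hnd X t)).symm.trans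
        (congrArg (fun s => (symmetrize k _ d s).1) (coordTensor_tensorMap₂ hnd φ.1 t).symm)⟩⟩
  sec_mem := mem_homog_natTrans.mpr fun X j t ht => by
    rw [add_zero]
    exact symmetrize_mem (piTensorMap_mem (fun i => coordHom_mem X (idx hnd i)) ht)
  map_sec X t := evalMap_symmetrize_coordTensor hnd X t

end tensorRetract

/-! ### The wreath product acting on tensor powers -/

section wreathAction
variable {k : Type u} [CommRing k] {A : Type u} [Ring A] [Algebra k A] [SuperAlgebra k A] {d : ℕ}
  {X : Type u} [AddCommGroup X] [Module k X] [Module Aᵐᵒᵖ X] [IsScalarTower k Aᵐᵒᵖ X]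
  [SuperModule k X] [GradedAction k Aᵐᵒᵖ X]

/-- The right action of `A^{⊗d}` on `X^{⊗d}`, with the rule of signs. -/
def tensorAct (k : Type u) [CommRing k] (A : Type u) [Ring A] [Algebra k A] [SuperAlgebra k A]
    (d : ℕ) (X : Type u) [AddCommGroup X] [Module k X] [Module Aᵐᵒᵖ X] [IsScalarTower k Aᵐᵒᵖ X]
    [SuperModule k X] [GradedAction k Aᵐᵒᵖ X] :
    TPow k X d →ₗ[k] TensorAlg k A d →ₗ[k] TPow k X d :=
  tensorMap₂ d (actMap (k := k) (A := A) (X := X))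

theorem tensorAct_mul (v : TPow k X d) (a b : TensorAlg k A d) :
    tensorAct k A d X (tensorAct k A d X v a) b = tensorAct k A d X v (a * b) :=
  have h : ∀ (x : X) (a b : A), actMap (k := k) (actMap (k := k) x a) b =
      actMap (k := k) x (mulMap k A a b) :=
    fun x a b => (mul_smul (MulOpposite.op b) (MulOpposite.op a) x).symm
  tensorMap₂_assoc (M₁ := X) (M₂ := A) (M₃ := A) actMap_even mulMap_even h v a b

theorem tensorAct_one (v : TPow k X d) : tensorAct k A d X v 1 = v :=
  tensorMap₂_id_right (μ := actMap (k := k) (A := A) (X := X))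
    (SuperAlgebra.one_mem (k := k) (R := A)) (fun x => one_smul Aᵐᵒᵖ x) v

theorem tensorAct_permAct (ρ : Equiv.Perm (Fin d)) (v : TPow k X d) (a : TensorAlg k A d) :
    tensorAct k A d X (permAct ρ v) a = permAct ρ (tensorAct k A d X v (ρ • a)) :=
  tensorMap₂_permAct_left actMap_even ρ v a

theorem wreathAct_eq (v : TPow k X d) (w : Wreath k A d) :
    wreathAct v w = ∑ ρ, permAct ρ (tensorAct k A d X v (w.coeff ρ)) := rfl

/-- The right action of `A ≀ 𝔖_d` on `X^{⊗d}`, as a bilinear map. -/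
def wreathBilin (k : Type u) [CommRing k] (A : Type u) [Ring A] [Algebra k A] [SuperAlgebra k A]
    (d : ℕ) (X : Type u) [AddCommGroup X] [Module k X] [Module Aᵐᵒᵖ X] [IsScalarTower k Aᵐᵒᵖ X]
    [SuperModule k X] [GradedAction k Aᵐᵒᵖ X] :
    TPow k X d →ₗ[k] Wreath k A d →ₗ[k] TPow k X d :=
  LinearMap.mk₂ k wreathAct
    (fun v v' w => by
      simp only [wreathAct_eq, map_add, LinearMap.add_apply, Finset.sum_add_distrib])
    (fun c v w => by simp only [wreathAct_eq, map_smul, LinearMap.smul_apply, Finset.smul_sum])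
    (fun v w w' => by
      simp only [wreathAct_eq, SkewMonoidAlgebra.coeff_add, Finsupp.add_apply, map_add,
        Finset.sum_add_distrib])
    (fun c v w => by
      simp only [wreathAct_eq, wreath_coeff_smul, map_smul, Finset.smul_sum])

theorem wreathBilin_apply (v : TPow k X d) (w : Wreath k A d) :
    wreathBilin k A d X v w = wreathAct v w := rfl

theorem wreathBilin_even : IsEven₂ (wreathBilin k A d X) := fun i j v hv _ hw =>
  Submodule.sum_mem _ fun ρ _ => permAct_mem ρ <|
    tensorMap₂_mem actMap_even i j v hv _ (mem_homog_pi.mp hw ρ)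

theorem wreathAct_one (v : TPow k X d) : wreathAct v (1 : Wreath k A d) = v := by
  rw [wreathAct_eq, Finset.sum_eq_single 1]
  · rw [SkewMonoidAlgebra.coeff_one, Finsupp.single_eq_same, tensorAct_one, permAct_one]
  · intro ρ _ hρ
    rw [SkewMonoidAlgebra.coeff_one, Finsupp.single_eq_of_ne hρ, map_zero, map_zero]
  · simp

theorem wreathAct_mul (v : TPow k X d) (a b : Wreath k A d) :
    wreathAct (wreathAct v a) b = wreathAct v (a * b) := by
  simp only [wreathAct_eq, wreath_coeff_mul, map_sum, LinearMap.sum_apply]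
  rw [Finset.sum_comm]
  conv_rhs => rw [Finset.sum_comm]
  refine Finset.sum_congr rfl fun ρ _ => ?_
  conv_rhs => rw [← Equiv.sum_comp (Equiv.mulLeft ρ)]
  refine Finset.sum_congr rfl fun σ _ => ?_
  simp only [Equiv.coe_mulLeft, inv_mul_cancel_left]
  rw [tensorAct_permAct, tensorAct_mul, ← permAct_mul]

theorem wreathBilin_twist_one (v : TPow k X d) :
    superTwist (wreathBilin k A d X).flip (1 : Wreath k A d) v = v :=
  superTwist_one SuperAlgebra.one_mem wreathAct_one v

end wreathAction

/-! ### Endomorphisms of the tensor power functor -/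

section wreathEnd
variable {k : Type u} [CommRing k] {A : Type u} [Ring A] [Algebra k A] [SuperAlgebra k A]
  {n d : ℕ}

/-- The actions of `Γ^d Hom(X, Y)` and of the wreath product on tensor powers commute. -/
theorem tensorMap₂_wreathAct {X Y : EvGenProj k A}
    {φ : TPow k (X.carrier →ₗ[Aᵐᵒᵖ] Y.carrier) d} (hφ : φ ∈ divPow k _ d)
    (v : TPow k X.carrier d) (w : Wreath k A d) :
    tensorMap₂ d (evalMap X Y) φ (wreathAct v w) =
      wreathAct (tensorMap₂ d (evalMap X Y) φ v) w := by
  rw [wreathAct_eq, wreathAct_eq, map_sum]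
  refine Finset.sum_congr rfl fun ρ _ => ?_
  have h := permAct_tensorMap₂ ρ (evalMap_even X Y) φ (tensorAct k A d X.carrier v (w.coeff ρ))
  rw [hφ ρ] at h
  rw [← h]
  congr 1
  exact (tensorMap₂_assoc (μ := evalMap X Y) (ν := actMap) (μ' := actMap) (ν' := evalMap X Y)
    (evalMap_even X Y) actMap_even
    (fun f x a => (f.map_smul (MulOpposite.op a) x).symm) φ v (w.coeff ρ)).symm

/-- The endomorphism of `⊗^d` given by an element of the wreath product: it maps `v` to
`(-1)^{|w| |v|} v · w`. -/
def wreathNat (k : Type u) [CommRing k] (A : Type u) [Ring A] [Algebra k A] [SuperAlgebra k A]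
    (d : ℕ) : Wreath k A d →ₗ[k] natTrans (tensorFunctor k A d) (tensorFunctor k A d) :=
  LinearMap.codRestrict _
    (LinearMap.pi fun X : EvGenProj k A => superTwist (wreathBilin k A d X.carrier).flip)
    fun w => by
    refine homog_induction (k := k) (p := fun w : Wreath k A d =>
      (LinearMap.pi fun X : EvGenProj k A => superTwist (wreathBilin k A d X.carrier).flip :
        Wreath k A d →ₗ[k] ∀ X : EvGenProj k A, (TPow k X.carrier d →ₗ[k] TPow k X.carrier d)) w ∈
        natTrans (tensorFunctor k A d) (tensorFunctor k A d)) w ?_ ?_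
    · intro a b ha hb
      rw [map_add]
      exact Submodule.add_mem _ ha hb
    · intro e w hw
      refine mem_natTrans (e := e) ⟨fun X j v hv => ?_, fun j X Y φ hφ => ?_⟩
      · rw [add_comm]
        exact superTwist_mem wreathBilin_even e j w hw v hv
      · suffices h : ∀ i, ∀ v ∈ homog k (M := TPow k X.carrier d) i,
            tensorMap₂ d (evalMap X Y) φ.1 (superTwist (wreathBilin k A d X.carrier).flip w v) =
              sgn k (j * e) • superTwist (wreathBilin k A d Y.carrier).flip w
                (tensorMap₂ d (evalMap X Y) φ.1 v) from ext_homog h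
        intro i v hv
        have h2 : tensorMap₂ d (evalMap X Y) φ.1 v ∈ homog k (j + i) :=
          tensorMap₂_mem (evalMap_even X Y) _ _ _ hφ _ hv
        rw [superTwist_apply _ hw hv, superTwist_apply _ hw h2, smul_smul, ← sgn_add, map_smul,
          LinearMap.flip_apply, LinearMap.flip_apply, wreathBilin_apply, wreathBilin_apply,
          tensorMap₂_wreathAct φ.2]
        have h1 : j * e + e * (j + i) = e * i := by
          rw [mul_add, mul_comm e j, ← add_assoc, CharTwo.add_self_eq_zero, zero_add]
        rw [h1]

/-- A specialization of `natTransSuperModule`, which instance search does not find for the concrete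
categories at hand. -/
instance tensorEndSuperModule :
    SuperModule k (natTrans (tensorFunctor k A d) (tensorFunctor k A d)) := natTransSuperModule _ _

theorem wreathNat_mem (i : ZMod 2) (w : Wreath k A d) (hw : w ∈ homog k i) :
    wreathNat k A d w ∈ homog k i := mem_homog_natTrans.mpr fun X j v hv => by
  rw [add_comm]
  exact superTwist_mem wreathBilin_even i j w hw v hv

theorem wreathNat_mul (a b : Wreath k A d) :
    wreathNat k A d (a * b) =
      superTwist (natComp (tensorFunctor k A d) (tensorFunctor k A d) (tensorFunctor k A d)).flip
        (wreathNat k A d a) (wreathNat k A d b) := by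
  refine LinearMap.congr_fun₂ (f := (mulMap k (Wreath k A d)).compr₂ (wreathNat k A d))
    (g := (superTwist (natComp (tensorFunctor k A d) (tensorFunctor k A d)
      (tensorFunctor k A d)).flip).compl₁₂ (wreathNat k A d) (wreathNat k A d))
    (ext_homog₂ fun i j a ha b hb => ?_) a b
  rw [LinearMap.compr₂_apply, LinearMap.compl₁₂_apply,
    superTwist_apply _ (wreathNat_mem i a ha) (wreathNat_mem j b hb)]
  have h1 : mulMap k (Wreath k A d) a b =
      sgn k (i * j) • superTwist (mulMap k (Wreath k A d)).flip b a := by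
    rw [superTwist_apply _ hb ha, smul_smul, mul_comm j i, sgn_mul_self, one_smul]
    rfl
  rw [h1, map_smul]
  congr 1
  refine Subtype.ext <| funext fun X => LinearMap.ext fun v => ?_
  exact superTwist_assoc (M := Wreath k A d) (N := TPow k X.carrier d) mulMap_even
    wreathBilin_even wreathAct_mul b a v

theorem tensorAct_basePoint (hnd : d ≤ n) (a : TensorAlg k A d) :
    tensorAct k A d (freeObj k A n).carrier (basePoint k A hnd) a =
      PiTensorProduct.map (fun i => inclMap k A (idx hnd i)) (show TPow k A d from a) := by
  refine (tensorMap₂_even_tprod _ (fun i => basisVec_mem (idx hnd i)) _).trans ?_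
  congr 2
  funext i
  exact actMap_basisVec (idx hnd i)

/-- The map `u ↦ (p_1 ⊗ ⋯ ⊗ p_d)(u.τ⁻¹)`, for the coordinate functions `p_i : A^n → A`. It
recovers the coefficient at `τ` of an element `w` of the wreath product from `(e_1 ⊗ ⋯ ⊗ e_d) · w`. -/
def coordTPow (hnd : d ≤ n) (τ : Equiv.Perm (Fin d)) :
    TPow k (freeObj k A n).carrier d →ₗ[k] TPow k A d :=
  PiTensorProduct.map (fun i => projMap k A (idx hnd i)) ∘ₗ permAct τ⁻¹

theorem coordTPow_wreathAct (hnd : d ≤ n) (w : Wreath k A d) (τ : Equiv.Perm (Fin d)) :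
    coordTPow hnd τ (wreathAct (basePoint k A hnd) w) = w.coeff τ := by
  rw [wreathAct_eq, map_sum, Finset.sum_eq_single τ]
  · rw [tensorAct_basePoint, coordTPow, LinearMap.comp_apply, ← permAct_mul, mul_inv_cancel,
      map_permAct_map (fun i => inclMap_mem (idx hnd i)) (fun i => projMap_inclMap (idx hnd i))
        (fun i j a hij => projMap_inclMap_ne (fun h => hij (Fin.castLE_injective hnd h)) a),
      if_pos rfl]
  · intro ρ _ hρ
    rw [tensorAct_basePoint, coordTPow, LinearMap.comp_apply, ← permAct_mul,
      map_permAct_map (fun i => inclMap_mem (idx hnd i)) (fun i => projMap_inclMap (idx hnd i))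
        (fun i j a hij => projMap_inclMap_ne (fun h => hij (Fin.castLE_injective hnd h)) a),
      if_neg fun h => hρ (mul_inv_eq_one.mp h)]
  · simp

/-- The idempotent `e` of the retract `⊗^d` of `Γ^{d,n}` projects `V^{⊗d}` onto the sum of the
images of `A^{⊗d}` under the wreath product. -/
theorem idem_eq_wreathAct (hnd : d ≤ n) (u : TPow k (freeObj k A n).carrier d) :
    evalBilin (tensorFunctor k A d) (freeObj k A n) (freeObj k A n) (tensorRetract hnd).idem u =
      wreathAct (basePoint k A hnd)
        (⟨Finsupp.equivFunOnFinite.symm fun τ => coordTPow hnd τ u⟩ : Wreath k A d) := by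
  change tensorMap₂ d (evalMap (freeObj k A n) (freeObj k A n))
    (symmetrize k _ d (coordTensor hnd (freeObj k A n) (basePoint k A hnd))).1 u = _
  rw [wreathAct_eq, symmetrize_val, map_sum, LinearMap.sum_apply]
  refine Finset.sum_congr rfl fun ρ _ => ?_
  rw [tensorMap₂_permAct_left (evalMap_even (freeObj k A n) (freeObj k A n)),
    tensorAct_basePoint]
  congr 1
  rw [coordTensor, basePoint, PiTensorProduct.map_tprod, tensorMap₂_even_tprod _ fun i =>
    coordHom_mem _ (idx hnd i) 0 _ (basisVec_mem (idx hnd i))]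
  change _ = PiTensorProduct.map (fun i => inclMap k A (idx hnd i))
    (PiTensorProduct.map (fun i => projMap k A (idx hnd i)) (permAct ρ⁻¹ u))
  refine Eq.trans ?_ (LinearMap.congr_fun (PiTensorProduct.map_comp _ _) (permAct ρ⁻¹ u))
  congr 2
  funext i
  exact LinearMap.ext fun a : Fin n → A =>
    LinearMap.congr_fun (actMap_basisVec (k := k) (idx hnd i)) (a (idx hnd i))

theorem evalPoint_wreathNat (hnd : d ≤ n) (w : Wreath k A d) :
    evalPoint (tensorFunctor k A d) (freeObj k A n) (tensorRetract hnd).point (wreathNat k A d w) =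
      wreathAct (basePoint k A hnd) w := by
  refine LinearMap.congr_fun
    (f := (superTwist (wreathBilin k A d (freeObj k A n).carrier).flip).flip (basePoint k A hnd))
    (g := wreathBilin k A d (freeObj k A n).carrier (basePoint k A hnd))
    (ext_homog fun i w hw => ?_) w
  rw [LinearMap.flip_apply, superTwist_apply _ hw (basePoint_mem hnd), mul_zero, sgn_zero, one_smul]
  rfl

/-- An endomorphism `η` of `⊗^d` is determined by `u = η(e_1 ⊗ ⋯ ⊗ e_d)`, and `u` is fixed by the
idempotent of the retract, so that it is `(e_1 ⊗ ⋯ ⊗ e_d) · w` for a unique `w`. -/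
theorem wreathNat_bijective : Function.Bijective (wreathNat k A d) := by
  -- The functor `⊗^d` does not involve `n`, so any `n ≥ d` serves to determine its endomorphisms.
  have hnd : d ≤ d := le_rfl
  constructor
  · refine (injective_iff_map_eq_zero _).mpr fun w hw => ?_
    have h := evalPoint_wreathNat hnd w
    rw [hw, map_zero] at h
    refine SkewMonoidAlgebra.ext fun τ => ?_
    exact (coordTPow_wreathAct hnd w τ).symm.trans
      ((congrArg (coordTPow hnd τ) h.symm).trans (map_zero _))
  · intro η
    refine ⟨_, (tensorRetract hnd).evalPoint_injective _ ((evalPoint_wreathNat hnd _).trans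
      ((idem_eq_wreathAct hnd _).symm.trans ((tensorRetract hnd).evalBilin_idem _ η)))⟩

/-- The wreath product is isomorphic to the super-opposite of the endomorphism superalgebra of
`⊗^d`. -/
def wreathEquiv (k : Type u) [CommRing k] (A : Type u) [Ring A] [Algebra k A] [SuperAlgebra k A]
    [Module.Finite k A] [Module.Free k A] (d : ℕ) :
    Wreath k A d ≃ₐ[k] SuperOpposite k ((polyCat k A d).End (tensorObj k A d)) :=
  AlgEquiv.ofBijective
    (AlgHom.ofLinearMap
      (show Wreath k A d →ₗ[k] SuperOpposite k ((polyCat k A d).End (tensorObj k A d)) from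
        wreathNat k A d)
      (Subtype.ext <| funext fun _ : EvGenProj k A => LinearMap.ext wreathBilin_twist_one)
      wreathNat_mul)
    wreathNat_bijective

theorem wreathEquiv_mem [Module.Finite k A] [Module.Free k A] (i : ZMod 2) (w : Wreath k A d)
    (hw : w ∈ homog k i) : wreathEquiv k A d w ∈ homog k i := wreathNat_mem i w hw

end wreathEnd

end SuperPoly

end

theorem theorem5p1 {k : Type u} [CommRing k] {A : Type u} [Ring A] [Algebra k A]
    [SuperAlgebra k A] [Module.Finite k A] [Module.Free k A] (n d : ℕ) (hnd : d ≤ n) :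
    ((∃ e : (tensorSpace k A n d).carrier ≃ₗ[SchurAlg k A n d] (homGammaTensor k A n d).carrier,
        (∀ i, ∀ v ∈ homog k (M := (tensorSpace k A n d).carrier) i, e v ∈ homog k i) ∧
        ∀ v, evalAtId k A n d (e v) = v) ∧
      Module.Finite (SchurAlg k A n d) (tensorSpace k A n d).carrier ∧
      IsSuperProjective.{u, u, u, w} k (SchurAlg k A n d) (tensorSpace k A n d).carrier) ∧
    ∃ (Φ : Wreath k A d ≃ₐ[k] SuperOpposite k ((polyCat k A d).End (tensorObj k A d)))
      (hΦ : ∀ i, ∀ w ∈ homog k (M := Wreath k A d) i, Φ w ∈ homog k i),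
      (∀ (i j : ZMod 2), ∀ w ∈ homog k (M := Wreath k A d) i, ∀ (X : EvGenProj k A),
        ∀ v ∈ homog k (M := TPow k X.carrier d) j,
          (Φ w).unop.1 X v = sgn k (i * j) • wreathAct v w) ∧
      (∀ F : (polyCat k A d).Obj,
        Module.Finite (Wreath k A d)
          ((homFunctor (tensorObj k A d) Φ.toAlgHom hΦ).obj F).carrier) ∧
      IsExactFunctor (homFunctor (tensorObj k A d) Φ.toAlgHom hΦ) := by
  have hfin := (tensorRetract (k := k) (A := A) hnd).finite_evalMod
  have hproj := (tensorRetract (k := k) (A := A) hnd).isSuperProjective_evalMod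
  refine ⟨⟨⟨(yonedaEquiv (tensorFunctor k A d) (freeObj k A n)).symm, ?_, ?_⟩, hfin, hproj⟩,
    wreathEquiv k A d, wreathEquiv_mem, ?_, ?_, ?_⟩
  · exact fun i v hv => yonedaNat_mem (tensorFunctor k A d) (freeObj k A n) hv
  · exact fun v => evalPoint_yonedaNat (tensorFunctor k A d) (freeObj k A n) v
  · intro i j w hw X v hv
    exact superTwist_apply (wreathBilin k A d X.carrier).flip hw hv
  · exact fun F => RepRetract.finite_homFunctor (T := tensorObj k A d) _ _
      (tensorRetract (k := k) (A := A) hnd) F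
  · exact RepRetract.isExactFunctor_homFunctor (T := tensorObj k A d) _ _
      (tensorRetract (k := k) (A := A) hnd)
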